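/- Let $d\ge 1$ be an integer and $p=1\le \tfrac{2}{d}$ (so $d\in\{1,2\}$), and let $\mu\in\mathbb{C}\setminus\{0\}$. Let $V:(0,\infty)\times\mathbb{R}^d\to\mathbb{C}$ belong to $L^\infty((0,\infty);(L^2\cap L^{q})(\mathbb{R}^d))$ for some $q\in[1,2)$. Suppose that $u\in C([0,\infty);L^2(\mathbb{R}^d))$ is a forward-global solution of $$ i\partial_t u+\Delta u = Vu+\mu|u|u $$ in the sense of distributions: for every Schwartz function $\varphi$, $i\partial_t\langle u(t),\varphi\rangle=\langle -\Delta u(t)+V(t)u(t)+\mu|u(t)|u(t),\varphi\rangle$ on $(0,\infty)$, where the right side is locally integrable on $[0,\infty)$ and $\langle f,g\rangle=\int_{\mathbb{R}^d} f\,\overline{g}\,dx$. Suppose that $$ u(t)=l(t)+e^{it\Delta}v_+ + o(1)\quad\text{in } L^2(\mathbb{R}^d)\text{ as } t\to\infty, $$ where $v_+\in L^2(\mathbb{R}^d)$ and $l\in L^\infty((0,\infty);(L^2\cap L^{r})(\mathbb{R}^d))$ for some $r\in[1,2)$. Assume additionally that there is a finite positive Borel measure $\nu$ on $\mathbb{R}^d$,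 singular with respect to Lebesgue measure, such that $$ \int_{\mathbb{R}^d}\varphi\,d\nu\;\ge\;\limsup_{t\to\infty}\int_{\mathbb{R}^d} t^d\bigl[|l(t,tx)|^2+|V(t,tx)|^2\bigr]\varphi(x)\,dx $$ for every nonnegative continuous function $\varphi$ on $\mathbb{R}^d$ that tends to $0$ as $|x|\to\infty$. (Since $l$ and $V$ are determined only up to null sets of times, the limit and the limsup as $t\to\infty$ are taken off a null set of times.) Then $v_+=0$. -/

import Mathlib

open MeasureTheory Filter Set
open scoped ENNReal SchwartzMap FourierTransform ComplexConjugate Topology ZeroAtInfty Laplacian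

noncomputable section

namespace LongRangeNLS

/-- The Euclidean space `ℝ^d`. -/
abbrev Space (d : ℕ) : Type := EuclideanSpace ℝ (Fin d)

/-- The complex Hilbert space `L²(ℝ^d)`. -/
abbrev LTwo (d : ℕ) : Type := Lp (α := Space d) ℂ 2 (volume : Measure (Space d))

/-- The symbol `e^{-it|ξ|²}` of the free Schrödinger group.  Mathlib's Fourier transform has the
kernel `e^{-2πi x·ξ}`, so the frequency called `ξ` in the kernel `e^{-i x·ξ}` is `2πξ` here. -/
def schrodingerSymbol (d : ℕ) (t : ℝ) (ξ : Space d) : ℂ :=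
  Complex.exp (((-(t * (2 * Real.pi * ‖ξ‖) ^ 2) : ℝ) : ℂ) * Complex.I)

/-- The symbol is a bounded measurable function. -/
theorem memLp_schrodingerSymbol (d : ℕ) (t : ℝ) :
    MemLp (schrodingerSymbol d t) ∞ (volume : Measure (Space d)) := by
  have hc : Continuous (schrodingerSymbol d t) := by
    unfold schrodingerSymbol
    fun_prop
  refine memLp_top_of_bound hc.aestronglyMeasurable 1 (Eventually.of_forall fun ξ => ?_)
  exact (Complex.norm_exp_ofReal_mul_I _).le

/-- The free Schrödinger group `e^{itΔ} = 𝓕⁻¹ e^{-it|ξ|²} 𝓕` on `L²(ℝ^d)`. -/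
def freeSchrodinger {d : ℕ} (t : ℝ) (f : LTwo d) : LTwo d :=
  𝓕⁻ (((memLp_schrodingerSymbol d t).toLp (schrodingerSymbol d t) • 𝓕 f : LTwo d))

/-- The power-type nonlinearity `F(z) = μ |z|^p z`. -/
def powerNonlinearity (μ : ℂ) (p : ℝ) (z : ℂ) : ℂ := μ * ((‖z‖ ^ p : ℝ) : ℂ) * z

/-- The pairing `⟨f, g⟩ = ∫ f(x) conj(g(x)) dx`. -/
def pairing {d : ℕ} (f g : Space d → ℂ) : ℂ := ∫ x, f x * conj (g x)

/-- `⟨-Δu + V u + F(u), φ⟩` at one instant, for a Schwartz function `φ`; the Laplacian acts on `u`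
in the sense of distributions. -/
def testedRHS {d : ℕ} (μ : ℂ) (p : ℝ) (V u : Space d → ℂ) (φ : 𝓢(Space d, ℂ)) : ℂ :=
  -pairing u (Δ φ : 𝓢(Space d, ℂ)) + pairing (fun x => V x * u x) φ
    + pairing (fun x => powerNonlinearity μ p (u x)) φ

/-- `u ∈ C([0,∞); L²(ℝ^d))` is a forward-global solution of
`i ∂ₜu + Δu = V u + μ |u|^p u` in the sense of distributions: for every Schwartz function `φ`,
`i ∂ₜ⟨u(t), φ⟩ = ⟨-Δu(t) + V(t)u(t) + F(u(t)), φ⟩`, where the right side is well defined for a.e.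
time and locally integrable in time, and the equation is understood in integrated form
(i.e. `⟨u(t), φ⟩` is locally absolutely continuous with the stated derivative a.e.). -/
structure IsForwardGlobalSolution {d : ℕ} (μ : ℂ) (p : ℝ) (V : ℝ → Space d → ℂ)
    (u : ℝ → LTwo d) : Prop where
  continuousOn : ContinuousOn u (Ici 0)
  pairing_defined : ∀ φ : 𝓢(Space d, ℂ), ∀ᵐ s ∂(volume.restrict (Ioi (0 : ℝ))),
    Integrable (fun x => V s x * u s x * conj (φ x)) ∧
    Integrable (fun x => powerNonlinearity μ p (u s x) * conj (φ x))
  locally_integrable : ∀ φ : 𝓢(Space d, ℂ), ∀ t : ℝ, 0 ≤ t →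
    IntervalIntegrable (fun s => testedRHS μ p (V s) (u s) φ) volume 0 t
  equation : ∀ φ : 𝓢(Space d, ℂ), ∀ t : ℝ, 0 ≤ t →
    Complex.I * (pairing (u t) φ - pairing (u 0) φ)
      = ∫ s in (0 : ℝ)..t, testedRHS μ p (V s) (u s) φ

/-- `f ∈ L^∞((0,∞); L²(ℝ^d) ∩ L^q(ℝ^d))`: `f` is (Lebesgue) measurable on `(0,∞) × ℝ^d`, and the
`L²` and `L^q` norms of `f(t)` are bounded uniformly in almost every `t > 0`. -/
structure MemLinftyTimeLTwoInterLq {d : ℕ} (q : ℝ≥0∞) (f : ℝ → Space d → ℂ) : Prop where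
  aestronglyMeasurable : AEStronglyMeasurable (Function.uncurry f)
    ((volume.restrict (Ioi (0 : ℝ))).prod (volume : Measure (Space d)))
  bounded : ∃ C : ℝ, ∀ᵐ t ∂(volume.restrict (Ioi (0 : ℝ))),
    eLpNorm (f t) 2 volume ≤ ENNReal.ofReal C ∧ eLpNorm (f t) q volume ≤ ENNReal.ofReal C

/-- The filter `t → ∞` for functions of time that are determined only up to null sets: limits along
it are essential limits, limsups along it are essential limsups. -/
def essAtTop : Filter ℝ := atTop ⊓ ae (volume : Measure ℝ)

/-- `⟨t^d [|l(t,tx)|² + |V(t,tx)|²], φ⟩` for a nonnegative real function `φ`, as an element of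
`[0,∞]`. -/
def rescaledMass {d : ℕ} (l V : ℝ → Space d → ℂ) (φ : Space d → ℝ) (t : ℝ) : ℝ≥0∞ :=
  ∫⁻ x, ENNReal.ofReal (t ^ d * (‖l t (t • x)‖ ^ 2 + ‖V t (t • x)‖ ^ 2) * φ x)

end LongRangeNLS

end

/-! Write `N = Vu + μ|u|u` and test the equation against a free solution `e^{itΔ}ψ`. Formally `i
∂ₜ⟨u, e^{itΔ}ψ⟩ = ⟨N, e^{itΔ}ψ⟩`, and the bracket on the left is bounded in time because `u` is
bounded in `L²`. If `v₊ ≠ 0`, then `ψ` can be chosen so that, after multiplication by a unimodular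
constant, the right side has real part at least `c/t` for almost every large `t`. Its integral then
grows like `log t`, a contradiction.

Lower bound. In `L²`, `e^{itΔ}v₊` approaches `W = profile t w` with `w = 𝓕 v₊`
(`tendsto_eLpNorm_freeSchrodinger_sub_profile`); for Schwartz `ψ`, `e^{itΔ}ψ` is uniformly close to
the profile of `g = 𝓕 ψ`. Both profiles carry the same oscillating factor, so it cancels and `μ|W|W`
tested against the profile of `g` is exactly `decayRate d t · μ ∫ |w| w ḡ`
(`integral_powerNonlinearity_profile`). With `g` close to `w/|w|` this is about `decayRate d t · μ
‖w‖²`, and `decayRate d t ≥ (4πt)⁻¹` because `d ≤ 2`.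

Errors. With `u = l + W + r`, Young's inequality bounds `N - μ|W|W` by `δ|W|² + δ⁻¹(|l|² + |V|² +
|r|²)`, up to a constant (`norm_forcing_sub_le`). The first term is small by the choice of `δ`, and
`r` tends to zero in `L²`. The terms in `l` and `V` are asymptotically controlled by the integral of
`|g|` against a dilate of `ν`. As that measure is singular, `g` can be close to `w/|w|` in
`L¹(|w|²dx)` and nearly vanish for it (`exists_schwartz_approx_phase`). `le_re_pairing_forcing`
collects these bounds.

The equation is given only for test functions independent of time, so the formal differentiation is
replaced by an estimate over short intervals with quadratic error, summed over fine subdivisions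
(`false_of_pairing_freeEvolution_ge`). -/

noncomputable section

namespace LongRangeNLS

variable {d : ℕ}

/-! ### Quadratic phases and the free evolution of Schwartz functions -/

/-- The quadratic phase `e^{ia|x|²}`. -/
def chirp (d : ℕ) (a : ℝ) (x : Space d) : ℂ :=
  Complex.exp (((a * ‖x‖ ^ 2 : ℝ) : ℂ) * Complex.I)

lemma schrodingerSymbol_eq_chirp (t : ℝ) :
    schrodingerSymbol d t = chirp d (-(4 * Real.pi ^ 2 * t)) := by
  funext ξ
  unfold schrodingerSymbol chirp
  congr 3
  ring

lemma norm_chirp (a : ℝ) (x : Space d) : ‖chirp d a x‖ = 1 :=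
  Complex.norm_exp_ofReal_mul_I _

lemma norm_chirp_sub_one_le (a : ℝ) (x : Space d) : ‖chirp d a x - 1‖ ≤ |a| * ‖x‖ ^ 2 := by
  have h := Real.norm_exp_I_mul_ofReal_sub_one_le (x := a * ‖x‖ ^ 2)
  rw [mul_comm Complex.I] at h
  refine h.trans_eq ?_
  rw [Real.norm_eq_abs, abs_mul, abs_of_nonneg (sq_nonneg ‖x‖)]

/-- For `|y| ≤ 1` the exponential series suffices; for `|y| > 1` both `|e^{iy} - 1|` and `|y|` are
at most `y²`, whence the factor `2`. Valid for every real `y`, the bound can be applied at all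
frequencies. -/
lemma norm_exp_ofReal_mul_I_sub_one_sub_le (y : ℝ) :
    ‖Complex.exp ((y : ℂ) * Complex.I) - 1 - (y : ℂ) * Complex.I‖ ≤ 2 * y ^ 2 := by
  have hn : ‖(y : ℂ) * Complex.I‖ = |y| := by simp
  rcases le_or_gt |y| 1 with h | h
  · refine (Complex.norm_exp_sub_one_sub_id_le (hn.trans_le h)).trans ?_
    rw [hn, sq_abs]
    nlinarith [sq_nonneg y]
  · have h1 := Real.norm_exp_I_mul_ofReal_sub_one_le (x := y)
    rw [mul_comm Complex.I, Real.norm_eq_abs] at h1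
    refine (norm_sub_le _ _).trans ?_
    rw [hn, ← sq_abs y]
    nlinarith

lemma hasTemperateGrowth_exp_ofReal_mul_I :
    (fun s : ℝ => Complex.exp ((s : ℂ) * Complex.I)).HasTemperateGrowth := by
  have hd : ∀ n : ℕ, iteratedDeriv n (fun s : ℝ => Complex.exp ((s : ℂ) * Complex.I))
      = fun s : ℝ => Complex.I ^ n * Complex.exp ((s : ℂ) * Complex.I) := by
    intro n
    induction n with
    | zero => simp
    | succ n ih =>
      rw [iteratedDeriv_succ, ih]
      funext s
      have h : HasDerivAt (fun s : ℝ => Complex.exp ((s : ℂ) * Complex.I))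
          (Complex.exp ((s : ℂ) * Complex.I) * (1 * Complex.I)) s :=
        ((Complex.ofRealCLM.hasDerivAt (x := s)).mul_const Complex.I).cexp
      rw [(h.const_mul (Complex.I ^ n)).deriv]
      ring
  refine ⟨?_, fun n => ⟨0, 1, fun s => ?_⟩⟩
  · exact (Complex.ofRealCLM.contDiff.mul contDiff_const).cexp
  · rw [norm_iteratedFDeriv_eq_norm_iteratedDeriv, hd]
    simp [Complex.norm_exp_ofReal_mul_I]

@[fun_prop]
lemma hasTemperateGrowth_chirp (a : ℝ) : (chirp d a).HasTemperateGrowth := by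
  have h : (fun x : Space d => a * ‖x‖ ^ 2).HasTemperateGrowth := by
    have := Function.hasTemperateGrowth_norm_sq (Space d)
    fun_prop
  exact hasTemperateGrowth_exp_ofReal_mul_I.comp h

lemma hasTemperateGrowth_schrodingerSymbol (t : ℝ) :
    (schrodingerSymbol d t).HasTemperateGrowth := by
  rw [schrodingerSymbol_eq_chirp]
  exact hasTemperateGrowth_chirp _

/-- The free Schrödinger group on Schwartz functions. -/
def freeEvolution (d : ℕ) (t : ℝ) : 𝓢(Space d, ℂ) →L[ℂ] 𝓢(Space d, ℂ) :=
  SchwartzMap.fourierMultiplierCLM ℂ (schrodingerSymbol d t)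

lemma fourier_freeEvolution_apply (t : ℝ) (f : 𝓢(Space d, ℂ)) (ξ : Space d) :
    𝓕 (freeEvolution d t f) ξ = schrodingerSymbol d t ξ * 𝓕 f ξ := by
  rw [freeEvolution, SchwartzMap.fourierMultiplierCLM_apply, FourierTransform.fourier_fourierInv_eq,
    SchwartzMap.smulLeftCLM_apply_apply (hasTemperateGrowth_schrodingerSymbol t), smul_eq_mul]

lemma fourier_laplacian_apply (f : 𝓢(Space d, ℂ)) (ξ : Space d) :
    𝓕 (Δ f : 𝓢(Space d, ℂ)) ξ = -((((2 * Real.pi * ‖ξ‖) ^ 2 : ℝ) : ℂ)) * 𝓕 f ξ := by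
  have h2 : (fun x : Space d => ‖x‖ ^ 2).HasTemperateGrowth :=
    Function.hasTemperateGrowth_norm_sq _
  rw [SchwartzMap.laplacian_eq_fourierMultiplierCLM, FourierTransform.fourier_smul,
    SchwartzMap.fourierMultiplierCLM_apply, FourierTransform.fourier_fourierInv_eq]
  have : (SchwartzMap.smulLeftCLM ℂ (fun x : Space d => ‖x‖ ^ 2) (𝓕 f)) ξ
      = (‖ξ‖ ^ 2) • 𝓕 f ξ :=
    SchwartzMap.smulLeftCLM_apply_apply h2 (𝓕 f) ξ
  rw [smul_apply, this]
  simp only [Complex.real_smul]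
  push_cast
  ring

lemma laplacian_freeEvolution (t : ℝ) (f : 𝓢(Space d, ℂ)) :
    (Δ (freeEvolution d t f) : 𝓢(Space d, ℂ)) = freeEvolution d t (Δ f) := by
  have h : 𝓕 (Δ (freeEvolution d t f) : 𝓢(Space d, ℂ)) = 𝓕 (freeEvolution d t (Δ f)) := by
    ext ξ
    rw [fourier_laplacian_apply, fourier_freeEvolution_apply, fourier_freeEvolution_apply,
      fourier_laplacian_apply]
    ring
  exact (FourierTransform.fourierEquiv ℂ 𝓢(Space d, ℂ)).injective h

/-- The two Fourier transforms agree on Schwartz functions, so pointwise formulas for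
`freeEvolution` pass to the group on `L²`. -/
lemma freeSchrodinger_toLp (t : ℝ) (f : 𝓢(Space d, ℂ)) :
    freeSchrodinger t (f.toLp 2) = (freeEvolution d t f).toLp 2 := by
  have h : ((memLp_schrodingerSymbol d t).toLp (schrodingerSymbol d t) • 𝓕 (f.toLp 2) : LTwo d)
      = (SchwartzMap.smulLeftCLM ℂ (schrodingerSymbol d t) (𝓕 f)).toLp 2 := by
    apply Lp.ext
    rw [SchwartzMap.toLp_fourier_eq]
    filter_upwards [Lp.coeFn_lpSMul (r := 2)
      ((memLp_schrodingerSymbol d t).toLp (schrodingerSymbol d t)) ((𝓕 f).toLp 2),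
      (memLp_schrodingerSymbol d t).coeFn_toLp, (𝓕 f).coeFn_toLp 2,
      (SchwartzMap.smulLeftCLM ℂ (schrodingerSymbol d t) (𝓕 f)).coeFn_toLp 2] with x h1 h2 h3 h4
    rw [h1, Pi.smul_apply', h2, h3, h4,
      SchwartzMap.smulLeftCLM_apply_apply (hasTemperateGrowth_schrodingerSymbol t)]
  rw [freeSchrodinger, h, SchwartzMap.toLp_fourierInv_eq]
  rfl

lemma norm_freeSchrodinger_le (t : ℝ) (f : LTwo d) : ‖freeSchrodinger t f‖ ≤ ‖f‖ := by
  have h1 : ‖freeSchrodinger t f‖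
      = ‖((memLp_schrodingerSymbol d t).toLp (schrodingerSymbol d t) • 𝓕 f : LTwo d)‖ :=
    (Lp.fourierTransformₗᵢ (Space d) ℂ).symm.norm_map _
  rw [h1, ← Lp.norm_fourier_eq f]
  refine Lp.norm_le_norm_of_ae_le ?_
  filter_upwards [Lp.coeFn_lpSMul (r := 2)
      ((memLp_schrodingerSymbol d t).toLp (schrodingerSymbol d t)) (𝓕 f),
      (memLp_schrodingerSymbol d t).coeFn_toLp] with x h1 h2
  rw [h1, Pi.smul_apply', h2, norm_smul, schrodingerSymbol_eq_chirp, norm_chirp, one_mul]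

lemma freeSchrodinger_sub (t : ℝ) (f g : LTwo d) :
    freeSchrodinger t (f - g) = freeSchrodinger t f - freeSchrodinger t g := by
  have hF : 𝓕 (f - g) = 𝓕 f - 𝓕 g := map_sub (Lp.fourierTransformₗᵢ (Space d) ℂ) f g
  unfold freeSchrodinger
  rw [hF, sub_eq_add_neg, Lp.add_smul, Lp.smul_neg, ← sub_eq_add_neg]
  exact map_sub (Lp.fourierTransformₗᵢ (Space d) ℂ).symm _ _

/-- A Schwartz function is controlled, in `L²` and in `L^∞`, by its Fourier transform. -/
lemma norm_toLp_le_of_fourier_le {f g : 𝓢(Space d, ℂ)} {C : ℝ}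
    (h : ∀ ξ, ‖𝓕 f ξ‖ ≤ C * ‖𝓕 g ξ‖) : ‖f.toLp 2‖ ≤ C * ‖g.toLp 2‖ := by
  rw [← SchwartzMap.norm_fourier_toL2_eq f, ← SchwartzMap.norm_fourier_toL2_eq g]
  refine Lp.norm_le_mul_norm_of_ae_le_mul ?_
  filter_upwards [(𝓕 f).coeFn_toLp 2, (𝓕 g).coeFn_toLp 2] with ξ h1 h2
  rw [h1, h2]
  exact h ξ

lemma norm_apply_le_integral_fourier (f : 𝓢(Space d, ℂ)) (x : Space d) :
    ‖f x‖ ≤ ∫ ξ, ‖𝓕 f ξ‖ := by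
  conv_lhs => rw [← FourierTransform.fourierInv_fourier_eq (F := 𝓢(Space d, ℂ)) f]
  rw [SchwartzMap.fourierInv_coe, Real.fourierInv_eq]
  refine (norm_integral_le_integral_norm _).trans_eq ?_
  simp

lemma norm_apply_le_of_fourier_le {f g : 𝓢(Space d, ℂ)} {C : ℝ}
    (h : ∀ ξ, ‖𝓕 f ξ‖ ≤ C * ‖𝓕 g ξ‖) (x : Space d) : ‖f x‖ ≤ C * ∫ ξ, ‖𝓕 g ξ‖ := by
  refine (norm_apply_le_integral_fourier f x).trans ?_
  rw [← integral_const_mul]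
  exact integral_mono (𝓕 f).integrable.norm ((𝓕 g).integrable.norm.const_mul C) h

/-! ### The kernel of the free evolution -/

/-- The factor `(4πit)^{-d/2} e^{i|x|²/4t}` of the free Schrödinger kernel. -/
def kernelFactor (d : ℕ) (t : ℝ) (x : Space d) : ℂ :=
  ((Real.pi : ℂ) / (4 * Real.pi ^ 2 * t * Complex.I)) ^ ((d : ℂ) / 2) * chirp d (4 * t)⁻¹ x

/-- The dispersive decay rate `(4πt)^{-d/2}`. -/
def decayRate (d : ℕ) (t : ℝ) : ℝ := (4 * Real.pi * t)⁻¹ ^ ((d : ℝ) / 2)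

/-- The asymptotic profile `(4πit)^{-d/2} e^{i|x|²/4t} w(x/4πt)`. -/
def profile (t : ℝ) (w : Space d → ℂ) (x : Space d) : ℂ :=
  kernelFactor d t x * w ((4 * Real.pi * t)⁻¹ • x)

lemma norm_kernelFactor {t : ℝ} (ht : 0 < t) (x : Space d) :
    ‖kernelFactor d t x‖ = decayRate d t := by
  have hpi := Real.pi_pos
  have h : ((d : ℂ) / 2) = (((d : ℝ) / 2 : ℝ) : ℂ) := by push_cast; rfl
  rw [kernelFactor, norm_mul, norm_chirp, mul_one, h, Complex.norm_cpow_real, decayRate]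
  congr 1
  simp only [norm_div, norm_mul, norm_pow, Complex.norm_real, Complex.norm_I, Real.norm_eq_abs,
    abs_of_pos hpi, abs_of_pos ht, Complex.norm_ofNat]
  field_simp

lemma decayRate_pos {t : ℝ} (ht : 0 < t) : 0 < decayRate d t := by
  have := Real.pi_pos
  unfold decayRate
  positivity

lemma decayRate_sq_mul {t : ℝ} (ht : 0 < t) :
    decayRate d t ^ 2 * (4 * Real.pi * t) ^ d = 1 := by
  have hpi := Real.pi_pos
  have h : 0 < 4 * Real.pi * t := by positivity
  rw [decayRate, ← Real.rpow_natCast, ← Real.rpow_mul (by positivity)]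
  rw [show (d : ℝ) / 2 * ((2 : ℕ) : ℝ) = d by push_cast; ring, Real.rpow_natCast, ← mul_pow,
    inv_mul_cancel₀ h.ne', one_pow]

lemma norm_profile {t : ℝ} (ht : 0 < t) (w : Space d → ℂ) (x : Space d) :
    ‖profile t w x‖ = decayRate d t * ‖w ((4 * Real.pi * t)⁻¹ • x)‖ := by
  rw [profile, norm_mul, norm_kernelFactor ht]

lemma continuous_chirp (a : ℝ) : Continuous (chirp d a) := by
  unfold chirp
  fun_prop

lemma continuous_kernelFactor (t : ℝ) : Continuous (kernelFactor d t) := by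
  unfold kernelFactor
  exact continuous_const.mul (continuous_chirp _)

/-- The regularized kernel identity, with `t` replaced by `t - iε`. -/
lemma integral_regularized_symbol {ε t : ℝ} (hε : 0 < ε) (f : 𝓢(Space d, ℂ)) (x : Space d) :
    ∫ ξ, Complex.exp (-(4 * Real.pi ^ 2 * (ε + t * Complex.I)) * ‖ξ‖ ^ 2
        + 2 * Real.pi * Complex.I * inner ℝ x ξ) * 𝓕 f ξ
      = ∫ y, ((Real.pi : ℂ) / (4 * Real.pi ^ 2 * (ε + t * Complex.I))) ^ ((d : ℂ) / 2)
        * Complex.exp (-Real.pi ^ 2 * ‖x - y‖ ^ 2 / (4 * Real.pi ^ 2 * (ε + t * Complex.I)))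
        * f y := by
  have hb : 0 < (4 * Real.pi ^ 2 * (ε + t * Complex.I) : ℂ).re := by
    have : (4 * Real.pi ^ 2 * (ε + t * Complex.I) : ℂ)
        = ((4 * Real.pi ^ 2 * ε : ℝ) : ℂ) + ((4 * Real.pi ^ 2 * t : ℝ) : ℂ) * Complex.I := by
      push_cast; ring
    rw [this]
    simp only [Complex.add_re, Complex.ofReal_re, Complex.re_ofReal_mul, Complex.I_re, mul_zero,
      add_zero]
    have := Real.pi_pos
    positivity
  have hint := GaussianFourier.integrable_cexp_neg_mul_sq_norm_add hb
    (2 * Real.pi * Complex.I) x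
  -- The multiplication formula `∫ Ĝ f = ∫ G 𝓕f`, for the Gaussian `G` made integrable by `ε > 0`.
  have h := VectorFourier.integral_fourierIntegral_smul_eq_flip (L := innerₗ (Space d))
      (μ := volume) (ν := volume) Real.continuous_fourierChar continuous_inner hint
      (f.integrable (μ := volume))
  rw [flip_innerₗ] at h
  simp only [smul_eq_mul] at h
  refine Eq.trans (Eq.symm h) ?_
  refine integral_congr_ae (Eventually.of_forall fun y => ?_)
  have := fourier_gaussian_innerProductSpace' hb x y
  rw [finrank_euclideanSpace_fin] at this
  simp only
  rw [← this]
  rfl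

/-- The regularization only inserts the damping `e^{-4π²ε|ξ|²} ≤ 1`, so `|𝓕 f|` dominates. -/
lemma tendsto_integral_regularized_symbol (t : ℝ) (f : 𝓢(Space d, ℂ)) (x : Space d) :
    Tendsto (fun ε : ℝ => ∫ ξ, Complex.exp (-(4 * Real.pi ^ 2 * (ε + t * Complex.I)) * ‖ξ‖ ^ 2
        + 2 * Real.pi * Complex.I * inner ℝ x ξ) * 𝓕 f ξ) (𝓝[>] 0)
      (𝓝 (freeEvolution d t f x)) := by
  have hlim : freeEvolution d t f x
      = ∫ ξ, Complex.exp (-(4 * Real.pi ^ 2 * ((0 : ℝ) + t * Complex.I)) * ‖ξ‖ ^ 2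
        + 2 * Real.pi * Complex.I * inner ℝ x ξ) * 𝓕 f ξ := by
    rw [freeEvolution, SchwartzMap.fourierMultiplierCLM_apply, SchwartzMap.fourierInv_coe,
      Real.fourierInv_eq']
    refine integral_congr_ae (Eventually.of_forall fun ξ => ?_)
    simp only
    rw [SchwartzMap.smulLeftCLM_apply_apply (hasTemperateGrowth_schrodingerSymbol t),
      schrodingerSymbol, smul_eq_mul, smul_eq_mul, ← mul_assoc, ← Complex.exp_add,
      real_inner_comm]
    congr 2
    push_cast
    ring
  rw [hlim]
  refine tendsto_integral_filter_of_dominated_convergence (fun ξ => ‖𝓕 f ξ‖) ?_ ?_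
    (𝓕 f).integrable.norm ?_
  · refine Eventually.of_forall fun ε => Continuous.aestronglyMeasurable ?_
    have := (𝓕 f).continuous
    fun_prop
  · filter_upwards [self_mem_nhdsWithin] with ε hε
    refine Eventually.of_forall fun ξ => ?_
    have he : (-(4 * Real.pi ^ 2 * (ε + t * Complex.I)) * ‖ξ‖ ^ 2
        + 2 * Real.pi * Complex.I * inner ℝ x ξ : ℂ)
        = ((-(4 * Real.pi ^ 2 * ε * ‖ξ‖ ^ 2) : ℝ) : ℂ)
          + ((2 * Real.pi * inner ℝ x ξ - 4 * Real.pi ^ 2 * t * ‖ξ‖ ^ 2 : ℝ) : ℂ) * Complex.I := by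
      push_cast; ring
    rw [norm_mul, he, Complex.exp_add, norm_mul, Complex.norm_exp_ofReal_mul_I, mul_one,
      Complex.norm_exp_ofReal]
    refine mul_le_of_le_one_left (norm_nonneg _) (Real.exp_le_one_iff.2 ?_)
    have : 0 ≤ 4 * Real.pi ^ 2 * ε * ‖ξ‖ ^ 2 := by
      have : 0 < ε := hε
      positivity
    linarith
  · refine Eventually.of_forall fun ξ => ?_
    refine Tendsto.mono_left (Continuous.tendsto ?_ 0) nhdsWithin_le_nhds
    fun_prop

/-- Since `|ε + it| ≥ t` and the Gaussian has modulus at most one, the regularized kernel is bounded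
by `decayRate d t` uniformly in `ε`. -/
lemma tendsto_integral_regularized_kernel {t : ℝ} (ht : 0 < t) (f : 𝓢(Space d, ℂ)) (x : Space d) :
    Tendsto (fun ε : ℝ =>
      ∫ y, ((Real.pi : ℂ) / (4 * Real.pi ^ 2 * (ε + t * Complex.I))) ^ ((d : ℂ) / 2)
        * Complex.exp (-Real.pi ^ 2 * ‖x - y‖ ^ 2 / (4 * Real.pi ^ 2 * (ε + t * Complex.I)))
        * f y) (𝓝[>] 0)
      (𝓝 (∫ y, kernelFactor d t (x - y) * f y)) := by
  have hpi := Real.pi_pos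
  have hne : ∀ ε : ℝ, (4 * Real.pi ^ 2 * (ε + t * Complex.I) : ℂ) ≠ 0 := by
    intro ε h
    have h2 : (ε + t * Complex.I : ℂ) = 0 := by
      refine (mul_eq_zero.1 h).resolve_left ?_
      norm_cast
      positivity
    have := congrArg Complex.im h2
    simp at this
    exact ht.ne' this
  have hlim : ∀ y, kernelFactor d t (x - y) * f y
      = ((Real.pi : ℂ) / (4 * Real.pi ^ 2 * ((0 : ℝ) + t * Complex.I))) ^ ((d : ℂ) / 2)
        * Complex.exp (-Real.pi ^ 2 * ‖x - y‖ ^ 2 / (4 * Real.pi ^ 2 * ((0 : ℝ) + t * Complex.I)))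
        * f y := by
    intro y
    unfold kernelFactor chirp
    congr 2
    · congr 2
      push_cast
      ring
    · congr 1
      have ht' : (t : ℂ) ≠ 0 := by exact_mod_cast ht.ne'
      have hp' : (Real.pi : ℂ) ≠ 0 := by exact_mod_cast hpi.ne'
      push_cast
      field_simp
      ring_nf
      simp
  simp_rw [hlim]
  refine tendsto_integral_filter_of_dominated_convergence
    (fun y => decayRate d t * ‖f y‖) ?_ ?_ (f.integrable.norm.const_mul _) ?_
  · refine Eventually.of_forall fun ε => Continuous.aestronglyMeasurable ?_
    have := f.continuous
    simp only [div_eq_mul_inv]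
    fun_prop
  · filter_upwards [self_mem_nhdsWithin] with ε hε
    have hε : 0 < ε := hε
    refine Eventually.of_forall fun y => ?_
    rw [norm_mul, norm_mul]
    refine mul_le_mul_of_nonneg_right ?_ (norm_nonneg _)
    refine (mul_le_of_le_one_right (norm_nonneg _) (?_ : _ ≤ (1 : ℝ))).trans ?_
    swap
    · have h : ((d : ℂ) / 2) = (((d : ℝ) / 2 : ℝ) : ℂ) := by push_cast; rfl
      rw [h, Complex.norm_cpow_real, decayRate]
      refine Real.rpow_le_rpow (norm_nonneg _) ?_ (by positivity)
      have him : t ≤ ‖(ε + t * Complex.I : ℂ)‖ := by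
        have := Complex.abs_im_le_norm (ε + t * Complex.I : ℂ)
        simp only [Complex.add_im, Complex.ofReal_im, Complex.im_ofReal_mul, Complex.I_im, mul_one,
          zero_add] at this
        exact (le_abs_self t).trans this
      simp only [norm_div, norm_mul, norm_pow, Complex.norm_real, Real.norm_eq_abs,
        abs_of_pos hpi, Complex.norm_ofNat]
      rw [inv_eq_one_div, div_le_div_iff₀ (mul_pos (by positivity) (ht.trans_le him)) (by positivity)]
      nlinarith [mul_le_mul_of_nonneg_left him (by positivity : 0 ≤ 4 * Real.pi ^ 2)]
    · rw [Complex.norm_exp]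
      refine Real.exp_le_one_iff.2 ?_
      have : (-Real.pi ^ 2 * ‖x - y‖ ^ 2 / (4 * Real.pi ^ 2 * (ε + t * Complex.I)) : ℂ)
          = ((-(Real.pi ^ 2 * ‖x - y‖ ^ 2 / (4 * Real.pi ^ 2)) : ℝ) : ℂ)
            * (ε + t * Complex.I : ℂ)⁻¹ := by
        push_cast
        rw [div_eq_mul_inv, mul_inv]
        ring
      rw [this, Complex.re_ofReal_mul, Complex.inv_re]
      have h1 : (ε + t * Complex.I : ℂ).re = ε := by simp
      rw [h1]
      have h2 : 0 ≤ Complex.normSq (ε + t * Complex.I : ℂ) := Complex.normSq_nonneg _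
      exact mul_nonpos_of_nonpos_of_nonneg (neg_nonpos.2 (by positivity)) (by positivity)
  · refine Eventually.of_forall fun y => ?_
    refine Tendsto.mono_left (ContinuousAt.tendsto (f := fun ε : ℝ =>
      ((Real.pi : ℂ) / (4 * Real.pi ^ 2 * (ε + t * Complex.I))) ^ ((d : ℂ) / 2)
        * Complex.exp (-Real.pi ^ 2 * ‖x - y‖ ^ 2 / (4 * Real.pi ^ 2 * (ε + t * Complex.I)))
        * f y) ?_) nhdsWithin_le_nhds
    have hc : ContinuousAt (fun ε : ℝ => (4 * Real.pi ^ 2 * (ε + t * Complex.I) : ℂ)) 0 := by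
      fun_prop
    refine ContinuousAt.mul (ContinuousAt.mul ?_ ?_) continuousAt_const
    · refine ContinuousAt.cpow (continuousAt_const.div hc (hne 0)) continuousAt_const ?_
      -- At `ε = 0` the base of the complex power is a positive multiple of `-i`: nonzero imaginary
      -- part, hence off the branch cut.
      right
      have : ((Real.pi : ℂ) / (4 * Real.pi ^ 2 * ((0 : ℝ) + t * Complex.I)))
          = (((4 * Real.pi * t)⁻¹ : ℝ) : ℂ) * (-Complex.I) := by
        have ht' : (t : ℂ) ≠ 0 := by exact_mod_cast ht.ne'
        have hp' : (Real.pi : ℂ) ≠ 0 := by exact_mod_cast hpi.ne'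
        push_cast
        field_simp
        ring_nf
        simp
      rw [this, Complex.im_ofReal_mul]
      simp only [Complex.neg_im, Complex.I_im]
      have : 0 < (4 * Real.pi * t)⁻¹ := by positivity
      linarith
    · exact (continuousAt_const.div hc (hne 0)).cexp

/-- The free evolution factors through the Fourier transform of `e^{i|·|²/4t} f`. -/
theorem freeEvolution_apply {t : ℝ} (ht : 0 < t) (f : 𝓢(Space d, ℂ)) (x : Space d) :
    freeEvolution d t f x
      = profile t (𝓕 (SchwartzMap.smulLeftCLM ℂ (chirp d (4 * t)⁻¹) f) : 𝓢(Space d, ℂ)) x := by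
  have h1 := tendsto_integral_regularized_symbol t f x
  have h2 := tendsto_integral_regularized_kernel ht f x
  have h3 : freeEvolution d t f x = ∫ y, kernelFactor d t (x - y) * f y := by
    refine tendsto_nhds_unique (h1.congr' ?_) h2
    filter_upwards [self_mem_nhdsWithin] with ε hε
    exact integral_regularized_symbol hε f x
  rw [h3, profile, SchwartzMap.fourier_coe, Real.fourier_eq', ← integral_const_mul]
  refine integral_congr_ae (Eventually.of_forall fun y => ?_)
  simp only
  rw [SchwartzMap.smulLeftCLM_apply_apply (hasTemperateGrowth_chirp _), smul_eq_mul, smul_eq_mul]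
  unfold kernelFactor chirp
  -- Expanding `|x - y|²` gives a chirp in `x`, a chirp in `y`, and a cross term that is the Fourier
  -- character at frequency `x/(4πt)`.
  have hexp : Complex.exp ((((4 * t)⁻¹ * ‖x - y‖ ^ 2 : ℝ) : ℂ) * Complex.I)
      = Complex.exp ((((4 * t)⁻¹ * ‖x‖ ^ 2 : ℝ) : ℂ) * Complex.I)
        * (Complex.exp (((-2 * Real.pi * inner ℝ y ((4 * Real.pi * t)⁻¹ • x) : ℝ) : ℂ) * Complex.I)
        * Complex.exp ((((4 * t)⁻¹ * ‖y‖ ^ 2 : ℝ) : ℂ) * Complex.I)) := by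
    rw [← Complex.exp_add, ← Complex.exp_add, ← add_mul, ← add_mul,
      ← Complex.ofReal_add, ← Complex.ofReal_add]
    congr 3
    rw [norm_sub_sq_real, real_inner_smul_right, real_inner_comm]
    have := Real.pi_pos
    field_simp
    ring
  rw [hexp]
  ring

/-! ### Asymptotic profiles -/

/-- The long-range condition enters here: the exponent `d/2` is at most one and the base is at most
one, so the decay is no faster than the non-integrable `1/t`. -/
lemma inv_le_decayRate (hd : (1 : ℝ) ≤ 2 / (d : ℝ)) {t : ℝ} (ht : 1 ≤ t) :
    (4 * Real.pi * t)⁻¹ ≤ decayRate d t := by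
  have hpi : 3 < Real.pi := Real.pi_gt_three
  have hd2 : (d : ℝ) / 2 ≤ 1 := by
    rcases (Nat.cast_nonneg (α := ℝ) d).eq_or_lt with h | h
    · rw [← h]; norm_num
    · rw [le_div_iff₀ h] at hd
      linarith
  have h1 : (1 : ℝ) ≤ 4 * Real.pi * t := by nlinarith
  have := Real.rpow_le_rpow_of_exponent_ge (inv_pos.2 (zero_lt_one.trans_le h1))
    (inv_le_one_of_one_le₀ h1) hd2
  rwa [Real.rpow_one] at this

lemma lintegral_comp_smul_space (F : Space d → ℝ≥0∞) {r : ℝ} (hr : 0 < r) :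
    ∫⁻ x, F (r • x) = ENNReal.ofReal (r ^ d)⁻¹ * ∫⁻ x, F x := by
  have he : MeasurableEmbedding (fun x : Space d => r • x) :=
    (Homeomorph.smulOfNeZero r hr.ne').measurableEmbedding
  rw [← he.lintegral_map, Measure.map_addHaar_smul volume hr.ne', lintegral_smul_measure,
    finrank_euclideanSpace_fin, abs_of_pos (by positivity), smul_eq_mul]

lemma aestronglyMeasurable_profile {t : ℝ} (ht : 0 < t) {w : Space d → ℂ}
    (hw : AEStronglyMeasurable w volume) : AEStronglyMeasurable (profile t w) volume := by
  have hpi := Real.pi_pos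
  refine (continuous_kernelFactor t).aestronglyMeasurable.mul ?_
  exact hw.comp_quasiMeasurePreserving
    (Measure.quasiMeasurePreserving_smul volume (r := (4 * Real.pi * t)⁻¹) (by positivity))

lemma ofReal_decayRate_sq_mul {t : ℝ} (ht : 0 < t) :
    ENNReal.ofReal (decayRate d t ^ 2) * ENNReal.ofReal (((4 * Real.pi * t)⁻¹ ^ d)⁻¹) = 1 := by
  rw [← ENNReal.ofReal_mul (by positivity), inv_pow, inv_inv, decayRate_sq_mul ht,
    ENNReal.ofReal_one]

/-- The square of the amplitude is exactly the inverse of the Jacobian `(4πt)^d` of the dilation. -/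
lemma eLpNorm_profile {t : ℝ} (ht : 0 < t) (w : Space d → ℂ) :
    eLpNorm (profile t w) 2 volume = eLpNorm w 2 volume := by
  have hpi := Real.pi_pos
  rw [eLpNorm_eq_lintegral_rpow_enorm_toReal two_ne_zero ENNReal.ofNat_ne_top,
    eLpNorm_eq_lintegral_rpow_enorm_toReal two_ne_zero ENNReal.ofNat_ne_top]
  congr 1
  have h : ∀ x : Space d, ‖profile t w x‖ₑ ^ (2 : ℝ≥0∞).toReal
      = ENNReal.ofReal (decayRate d t ^ 2)
        * ‖w ((4 * Real.pi * t)⁻¹ • x)‖ₑ ^ (2 : ℝ≥0∞).toReal := by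
    intro x
    rw [← ofReal_norm, norm_profile ht, ENNReal.ofReal_mul (decayRate_pos ht).le,
      ofReal_norm, ENNReal.mul_rpow_of_nonneg _ _ (by positivity),
      ENNReal.ofReal_pow (decayRate_pos ht).le]
    norm_num
  simp_rw [h]
  rw [lintegral_const_mul' _ _ ENNReal.ofReal_ne_top,
    lintegral_comp_smul_space (fun x => ‖w x‖ₑ ^ (2 : ℝ≥0∞).toReal)
      (r := (4 * Real.pi * t)⁻¹) (by positivity), ← mul_assoc, ofReal_decayRate_sq_mul ht, one_mul]

/-- Multiplication of Schwartz functions by `e^{ia|x|²} - 1`. -/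
def chirpSub (d : ℕ) (a : ℝ) (f : 𝓢(Space d, ℂ)) : 𝓢(Space d, ℂ) :=
  SchwartzMap.smulLeftCLM ℂ (chirp d a) f - f

lemma norm_chirpSub_le (a : ℝ) (f : 𝓢(Space d, ℂ)) (x : Space d) :
    ‖chirpSub d a f x‖ ≤ |a| * (‖x‖ ^ 2 * ‖f x‖) := by
  rw [chirpSub, sub_apply, SchwartzMap.smulLeftCLM_apply_apply (hasTemperateGrowth_chirp _),
    smul_eq_mul, ← sub_one_mul, norm_mul, ← mul_assoc]
  exact mul_le_mul_of_nonneg_right (norm_chirp_sub_one_le a x) (norm_nonneg _)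

/-- The error is again a profile, now of the transform of `(e^{i|x|²/4t} - 1) f`, which is at most
`|x|²|f|/4t`. This yields both the uniform and the `L²` rate `1/t`. -/
lemma freeEvolution_sub_profile {t : ℝ} (ht : 0 < t) (f : 𝓢(Space d, ℂ)) (x : Space d) :
    freeEvolution d t f x - profile t (𝓕 f : 𝓢(Space d, ℂ)) x
      = profile t (𝓕 (chirpSub d (4 * t)⁻¹ f) : 𝓢(Space d, ℂ)) x := by
  have h : 𝓕 (chirpSub d (4 * t)⁻¹ f)
      = 𝓕 (SchwartzMap.smulLeftCLM ℂ (chirp d (4 * t)⁻¹) f) - 𝓕 f :=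
    map_sub (FourierTransform.fourierEquiv ℂ 𝓢(Space d, ℂ)) _ _
  rw [freeEvolution_apply ht, h]
  simp only [profile, sub_apply, mul_sub]

/-- Pointwise asymptotics of the free evolution of a Schwartz function. -/
theorem norm_freeEvolution_sub_profile_le (f : 𝓢(Space d, ℂ)) :
    ∃ C : ℝ, 0 ≤ C ∧ ∀ t : ℝ, 0 < t → ∀ x,
      ‖freeEvolution d t f x - profile t (𝓕 f : 𝓢(Space d, ℂ)) x‖ ≤ decayRate d t * (C / t) := by
  refine ⟨∫ x, ‖x‖ ^ 2 * ‖f x‖, by positivity, fun t ht x => ?_⟩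
  rw [freeEvolution_sub_profile ht, norm_profile ht]
  refine mul_le_mul_of_nonneg_left ?_ (decayRate_pos ht).le
  refine (SchwartzMap.norm_fourier_apply_le_toLp_one _ _).trans ?_
  have hI : Integrable (fun x : Space d => ‖x‖ ^ 2 * ‖f x‖) := f.integrable_pow_mul volume 2
  have hnn : 0 ≤ ∫ x : Space d, ‖x‖ ^ 2 * ‖f x‖ := by positivity
  rw [SchwartzMap.norm_toLp_one]
  calc ∫ x, ‖chirpSub d (4 * t)⁻¹ f x‖
      ≤ ∫ x, |(4 * t)⁻¹| * (‖x‖ ^ 2 * ‖f x‖) :=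
        integral_mono (chirpSub d (4 * t)⁻¹ f).integrable.norm (hI.const_mul _)
          (norm_chirpSub_le _ f)
    _ = (4 * t)⁻¹ * ∫ x, ‖x‖ ^ 2 * ‖f x‖ := by
        rw [integral_const_mul, abs_of_pos (by positivity)]
    _ ≤ (∫ x, ‖x‖ ^ 2 * ‖f x‖) / t := by
        rw [div_eq_inv_mul]
        refine mul_le_mul_of_nonneg_right (inv_anti₀ ht (by linarith)) hnn

lemma eLpNorm_freeSchrodinger_toLp_sub_profile_le (f : 𝓢(Space d, ℂ)) :
    ∃ C : ℝ, 0 ≤ C ∧ ∀ t : ℝ, 0 < t →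
      eLpNorm (fun x => freeSchrodinger t (f.toLp 2) x - profile t (𝓕 f : 𝓢(Space d, ℂ)) x) 2
        volume ≤ ENNReal.ofReal (C / t) := by
  have hg : (fun x : Space d => ‖x‖ ^ 2).HasTemperateGrowth :=
    Function.hasTemperateGrowth_norm_sq _
  set k : 𝓢(Space d, ℂ) := SchwartzMap.smulLeftCLM ℂ (fun x : Space d => ‖x‖ ^ 2) f with hk
  refine ⟨‖k.toLp 2‖, norm_nonneg _, fun t ht => ?_⟩
  have hae : (fun x => freeSchrodinger t (f.toLp 2) x - profile t (𝓕 f : 𝓢(Space d, ℂ)) x)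
      =ᵐ[volume] profile t (𝓕 (chirpSub d (4 * t)⁻¹ f) : 𝓢(Space d, ℂ)) := by
    rw [freeSchrodinger_toLp]
    filter_upwards [(freeEvolution d t f).coeFn_toLp 2 volume] with x hx
    rw [hx, freeEvolution_sub_profile ht]
  rw [eLpNorm_congr_ae hae, eLpNorm_profile ht, ← eLpNorm_congr_ae
    ((𝓕 (chirpSub d (4 * t)⁻¹ f)).coeFn_toLp 2 volume), ← Lp.enorm_def, ← ofReal_norm,
    SchwartzMap.norm_fourier_toL2_eq]
  refine ENNReal.ofReal_le_ofReal ?_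
  have h1 : ‖(chirpSub d (4 * t)⁻¹ f).toLp 2‖ ≤ (4 * t)⁻¹ * ‖k.toLp 2‖ := by
    refine Lp.norm_le_mul_norm_of_ae_le_mul ?_
    filter_upwards [(chirpSub d (4 * t)⁻¹ f).coeFn_toLp 2 volume, k.coeFn_toLp 2 volume] with x h1 h2
    rw [h1, h2, hk, SchwartzMap.smulLeftCLM_apply_apply hg]
    refine (norm_chirpSub_le _ f x).trans_eq ?_
    rw [abs_of_pos (by positivity), norm_smul, norm_pow, norm_norm]
  refine h1.trans ?_
  rw [div_eq_inv_mul]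
  exact mul_le_mul_of_nonneg_right (inv_anti₀ ht (by linarith)) (norm_nonneg _)

/-- `L²` asymptotics of the free evolution. -/
theorem tendsto_eLpNorm_freeSchrodinger_sub_profile (v : LTwo d) :
    Tendsto (fun t : ℝ => eLpNorm (fun x => freeSchrodinger t v x
      - profile t (𝓕 v : LTwo d) x) 2 volume) atTop (𝓝 0) := by
  rw [ENNReal.tendsto_nhds_zero]
  intro ε hε
  obtain ⟨δ, hδ, hδε⟩ : ∃ δ : ℝ, 0 < δ ∧ ENNReal.ofReal (3 * δ) ≤ ε := by
    rcases eq_or_ne ε ⊤ with rfl | hε'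
    · exact ⟨1, one_pos, le_top⟩
    · refine ⟨ε.toReal / 3, div_pos (ENNReal.toReal_pos hε.ne' hε') three_pos, ?_⟩
      rw [mul_div_cancel₀ _ three_ne_zero, ENNReal.ofReal_toReal hε']
  obtain ⟨f, hf⟩ : ∃ f : 𝓢(Space d, ℂ), ‖v - f.toLp 2 volume‖ < δ := by
    have := (SchwartzMap.denseRange_toLpCLM (E := Space d) (F := ℂ) (p := 2) (μ := volume)
      ENNReal.ofNat_ne_top).exists_dist_lt v hδ
    obtain ⟨f, hf⟩ := this
    exact ⟨f, by rwa [← dist_eq_norm]⟩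
  obtain ⟨C, hC, hCt⟩ := eLpNorm_freeSchrodinger_toLp_sub_profile_le f
  filter_upwards [eventually_gt_atTop 0, eventually_ge_atTop (C / δ)] with t ht htC
  have hCδ : C / t ≤ δ := by
    rw [div_le_iff₀ ht]
    rwa [div_le_iff₀ hδ, mul_comm] at htC
  have hF : 𝓕 (f.toLp 2 volume) - 𝓕 v = 𝓕 (f.toLp 2 volume - v) :=
    (map_sub (Lp.fourierTransformₗᵢ (Space d) ℂ) _ _).symm
  have h1 : eLpNorm (freeSchrodinger t (v - f.toLp 2 volume)) 2 volume ≤ ENNReal.ofReal δ := by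
    rw [← Lp.enorm_def, ← ofReal_norm]
    exact ENNReal.ofReal_le_ofReal ((norm_freeSchrodinger_le t _).trans hf.le)
  have h2 := (hCt t ht).trans (ENNReal.ofReal_le_ofReal hCδ)
  have h3 : eLpNorm (profile t (𝓕 (f.toLp 2 volume - v) : LTwo d)) 2 volume ≤ ENNReal.ofReal δ := by
    rw [eLpNorm_profile ht, ← Lp.enorm_def, ← ofReal_norm, Lp.norm_fourier_eq,
      norm_sub_rev]
    exact ENNReal.ofReal_le_ofReal hf.le
  have hq := (Measure.quasiMeasurePreserving_smul (volume : Measure (Space d)) (r := (4 * Real.pi * t)⁻¹)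
    (inv_pos.2 (mul_pos (mul_pos four_pos Real.pi_pos) ht)).ne')
  -- Compare with a Schwartz approximant `f`: the outer two terms are small uniformly in `t` because
  -- the group is a contraction and the profile map preserves the `L²` norm; the middle one is
  -- `O(1/t)`.
  have hae : (fun x => freeSchrodinger t v x - profile t (𝓕 v : LTwo d) x)
      =ᵐ[volume] (⇑(freeSchrodinger t (v - f.toLp 2 volume))
        + fun x => freeSchrodinger t (f.toLp 2 volume) x - profile t (𝓕 f : 𝓢(Space d, ℂ)) x)
        + profile t (𝓕 (f.toLp 2 volume - v) : LTwo d) := by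
    rw [freeSchrodinger_sub, ← hF]
    filter_upwards [Lp.coeFn_sub (freeSchrodinger t v) (freeSchrodinger t (f.toLp 2 volume)),
      hq.ae (Lp.coeFn_sub (𝓕 (f.toLp 2 volume)) (𝓕 v)),
      hq.ae ((𝓕 f).coeFn_toLp 2 volume)] with x h1 h2 h3
    simp only [Pi.add_apply, profile]
    rw [h1, h2, Pi.sub_apply, Pi.sub_apply, SchwartzMap.toLp_fourier_eq, h3]
    ring
  have hm1 : AEStronglyMeasurable
      (fun x => freeSchrodinger t (f.toLp 2 volume) x - profile t (𝓕 f : 𝓢(Space d, ℂ)) x) volume :=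
    (Lp.aestronglyMeasurable _).sub
      (aestronglyMeasurable_profile ht (𝓕 f).continuous.aestronglyMeasurable)
  have hm2 := aestronglyMeasurable_profile ht (Lp.aestronglyMeasurable (𝓕 (f.toLp 2 volume - v)))
  rw [eLpNorm_congr_ae hae]
  calc _ ≤ ENNReal.ofReal δ + ENNReal.ofReal δ + ENNReal.ofReal δ :=
        (eLpNorm_add_le ((Lp.aestronglyMeasurable _).add hm1) hm2 one_le_two).trans (add_le_add
          ((eLpNorm_add_le (Lp.aestronglyMeasurable _) hm1 one_le_two).trans
            (add_le_add h1 h2)) h3)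
    _ = ENNReal.ofReal (3 * δ) := by
        rw [← ENNReal.ofReal_add hδ.le hδ.le, ← ENNReal.ofReal_add (by linarith) hδ.le]
        congr 1
        ring
    _ ≤ ε := hδε

/-! ### Pairings with Schwartz functions -/

lemma pairing_eq_inner (f : LTwo d) (φ : 𝓢(Space d, ℂ)) :
    pairing f φ = inner ℂ (φ.toLp 2 volume) f := by
  rw [L2.inner_def, pairing]
  refine integral_congr_ae ?_
  filter_upwards [φ.coeFn_toLp 2 volume] with x hx
  rw [hx, RCLike.inner_apply]

lemma norm_pairing_le (f : LTwo d) (φ : 𝓢(Space d, ℂ)) :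
    ‖pairing f φ‖ ≤ ‖f‖ * ‖φ.toLp 2 volume‖ := by
  rw [pairing_eq_inner, mul_comm]
  exact norm_inner_le_norm _ _

lemma toLp_two_sub (φ ψ : 𝓢(Space d, ℂ)) :
    (φ - ψ).toLp 2 volume = φ.toLp 2 volume - ψ.toLp 2 volume :=
  map_sub (SchwartzMap.toLpCLM ℂ (E := Space d) ℂ 2 volume) φ ψ

lemma pairing_sub_right (f : LTwo d) (φ ψ : 𝓢(Space d, ℂ)) :
    pairing f ⇑(φ - ψ) = pairing f φ - pairing f ψ := by
  rw [pairing_eq_inner, pairing_eq_inner, pairing_eq_inner, toLp_two_sub, inner_sub_left]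

lemma pairing_smul_right (f : LTwo d) (c : ℂ) (φ : 𝓢(Space d, ℂ)) :
    pairing f ⇑(c • φ) = conj c * pairing f φ := by
  have h : (c • φ).toLp 2 volume = c • φ.toLp 2 volume :=
    map_smul (SchwartzMap.toLpCLM ℂ (E := Space d) ℂ 2 volume) c φ
  rw [pairing_eq_inner, pairing_eq_inner, h, inner_smul_left]

lemma integrable_mul_conj_schwartz {N : Space d → ℂ} (hN : Integrable N) (φ : 𝓢(Space d, ℂ)) :
    Integrable fun x => N x * conj (φ x) := by
  obtain ⟨C, hC⟩ : ∃ C, ∀ x, ‖φ x‖ ≤ C := ⟨_, SchwartzMap.norm_le_seminorm ℝ φ⟩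
  refine hN.mul_bdd (c := C) (Complex.continuous_conj.comp φ.continuous).aestronglyMeasurable ?_
  exact Eventually.of_forall fun x => by simpa using hC x

lemma norm_pairing_le_of_norm_le {N : Space d → ℂ} (hN : Integrable N) {φ : Space d → ℂ}
    {M : ℝ} (hM : ∀ x, ‖φ x‖ ≤ M) : ‖pairing N φ‖ ≤ (∫ x, ‖N x‖) * M := by
  rw [pairing, ← integral_mul_const]
  refine norm_integral_le_of_norm_le (hN.norm.mul_const M) (Eventually.of_forall fun x => ?_)
  rw [norm_mul, RCLike.norm_conj]
  exact mul_le_mul_of_nonneg_left (hM x) (norm_nonneg _)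

lemma pairing_sub_right_of_integrable {N : Space d → ℂ} (hN : Integrable N)
    (φ ψ : 𝓢(Space d, ℂ)) : pairing N ⇑(φ - ψ) = pairing N φ - pairing N ψ := by
  rw [pairing, pairing, pairing, ← integral_sub (integrable_mul_conj_schwartz hN φ)
    (integrable_mul_conj_schwartz hN ψ)]
  simp only [sub_apply, map_sub, mul_sub]

/-! ### Time regularity of the free evolution -/

lemma norm_schrodingerSymbol (t : ℝ) (ξ : Space d) : ‖schrodingerSymbol d t ξ‖ = 1 :=
  Complex.norm_exp_ofReal_mul_I _

lemma norm_toLp_freeEvolution_le (t : ℝ) (f : 𝓢(Space d, ℂ)) :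
    ‖(freeEvolution d t f).toLp 2 volume‖ ≤ ‖f.toLp 2 volume‖ := by
  refine (norm_toLp_le_of_fourier_le (C := 1) fun ξ => ?_).trans_eq (one_mul _)
  rw [fourier_freeEvolution_apply, norm_mul, norm_schrodingerSymbol]

lemma norm_freeEvolution_apply_le (t : ℝ) (f : 𝓢(Space d, ℂ)) (x : Space d) :
    ‖freeEvolution d t f x‖ ≤ ∫ ξ, ‖𝓕 f ξ‖ := by
  refine (norm_apply_le_of_fourier_le (C := 1) (fun ξ => ?_) x).trans_eq (one_mul _)
  rw [fourier_freeEvolution_apply, norm_mul, norm_schrodingerSymbol]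

lemma schrodingerSymbol_split (a b : ℝ) (ξ : Space d) :
    schrodingerSymbol d b ξ = schrodingerSymbol d a ξ
      * Complex.exp (((-((b - a) * (2 * Real.pi * ‖ξ‖) ^ 2) : ℝ) : ℂ) * Complex.I) := by
  rw [schrodingerSymbol, schrodingerSymbol, ← Complex.exp_add, ← add_mul, ← Complex.ofReal_add]
  congr 3
  ring

lemma schwartz_fourier_sub (f g : 𝓢(Space d, ℂ)) : 𝓕 (f - g) = 𝓕 f - 𝓕 g :=
  map_sub (FourierTransform.fourierEquiv ℂ 𝓢(Space d, ℂ)) f g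

lemma norm_freeEvolution_sub_apply_le (a b : ℝ) (f : 𝓢(Space d, ℂ)) (x : Space d) :
    ‖(freeEvolution d b f - freeEvolution d a f) x‖
      ≤ |b - a| * ∫ ξ, ‖𝓕 (Δ f : 𝓢(Space d, ℂ)) ξ‖ := by
  refine norm_apply_le_of_fourier_le (fun ξ => ?_) x
  rw [schwartz_fourier_sub, sub_apply, fourier_freeEvolution_apply, fourier_freeEvolution_apply,
    fourier_laplacian_apply, schrodingerSymbol_split a b, ← sub_mul, ← mul_sub_one, norm_mul,
    norm_mul, norm_schrodingerSymbol, one_mul, norm_mul, ← mul_assoc]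
  refine mul_le_mul_of_nonneg_right ?_ (norm_nonneg _)
  have h := Real.norm_exp_I_mul_ofReal_sub_one_le (x := -((b - a) * (2 * Real.pi * ‖ξ‖) ^ 2))
  rw [mul_comm Complex.I] at h
  refine h.trans_eq ?_
  rw [norm_neg, norm_neg, norm_mul, Real.norm_eq_abs, Complex.norm_real]

/-- On the Fourier side this is the second-order remainder of `e^{-i(b-a)q}` with `q = (2π|ξ|)²`,
and `q²` is the symbol of `Δ²`. -/
lemma norm_toLp_freeEvolution_taylor_le (a b : ℝ) (f : 𝓢(Space d, ℂ)) :
    ‖(freeEvolution d b f - freeEvolution d a f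
        - (Complex.I * ((b - a : ℝ) : ℂ)) • (Δ (freeEvolution d a f) : 𝓢(Space d, ℂ))).toLp 2
        volume‖ ≤ 2 * (b - a) ^ 2 * ‖(Δ (Δ f : 𝓢(Space d, ℂ)) : 𝓢(Space d, ℂ)).toLp 2 volume‖ := by
  refine norm_toLp_le_of_fourier_le fun ξ => ?_
  rw [schwartz_fourier_sub, schwartz_fourier_sub, FourierTransform.fourier_smul, sub_apply,
    sub_apply, smul_apply, fourier_laplacian_apply, fourier_laplacian_apply,
    fourier_laplacian_apply, fourier_freeEvolution_apply, fourier_freeEvolution_apply,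
    schrodingerSymbol_split a b, smul_eq_mul]
  set q : ℝ := (2 * Real.pi * ‖ξ‖) ^ 2
  have h := norm_exp_ofReal_mul_I_sub_one_sub_le (-((b - a) * q))
  have he : schrodingerSymbol d a ξ * Complex.exp (((-((b - a) * q) : ℝ) : ℂ) * Complex.I) * 𝓕 f ξ
      - schrodingerSymbol d a ξ * 𝓕 f ξ
      - Complex.I * ((b - a : ℝ) : ℂ) * (-(q : ℂ) * (schrodingerSymbol d a ξ * 𝓕 f ξ))
      = schrodingerSymbol d a ξ * ((Complex.exp (((-((b - a) * q) : ℝ) : ℂ) * Complex.I) - 1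
        - ((-((b - a) * q) : ℝ) : ℂ) * Complex.I) * 𝓕 f ξ) := by
    push_cast
    ring
  rw [he, norm_mul, norm_schrodingerSymbol, one_mul, norm_mul, norm_mul, norm_mul, norm_neg,
    Complex.norm_real]
  calc _ ≤ 2 * (-((b - a) * q)) ^ 2 * ‖𝓕 f ξ‖ := mul_le_mul_of_nonneg_right h (norm_nonneg _)
    _ = _ := by
      rw [Real.norm_eq_abs, ← mul_assoc |q| |q|, abs_mul_abs_self]
      ring

/-! ### Growth of the tested solution -/

/-- Cutting `[a, b]` into `n + 1` equal steps reduces the total defect to `C(b-a)²/(n+1)`, which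
tends to zero. No differentiability of `f` is needed. -/
lemma le_of_forall_sub_sq_le {f : ℝ → ℝ} {T C : ℝ}
    (h : ∀ a b, T ≤ a → a ≤ b → f a - C * (b - a) ^ 2 ≤ f b) {a b : ℝ} (ha : T ≤ a)
    (hab : a ≤ b) : f a ≤ f b := by
  have key : ∀ n : ℕ, f a - C * (b - a) ^ 2 / (n + 1) ≤ f b := by
    intro n
    have hn : (0 : ℝ) < n + 1 := by positivity
    set δ : ℝ := (b - a) / (n + 1) with hδ
    have hδ0 : 0 ≤ δ := div_nonneg (sub_nonneg.2 hab) hn.le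
    have hk : ∀ k : ℕ, f a - k * (C * δ ^ 2) ≤ f (a + k * δ) := by
      intro k
      induction k with
      | zero => simp
      | succ k ih =>
        have := h (a + k * δ) (a + (k + 1 : ℕ) * δ) (by nlinarith [mul_nonneg k.cast_nonneg hδ0])
          (by push_cast; linarith)
        have he : a + (k + 1 : ℕ) * δ - (a + k * δ) = δ := by push_cast; ring
        rw [he] at this
        push_cast at this ⊢
        linarith
    have := hk (n + 1)
    have e1 : a + ((n + 1 : ℕ) : ℝ) * δ = b := by
      rw [hδ]; push_cast; field_simp; ring
    have e2 : ((n + 1 : ℕ) : ℝ) * (C * δ ^ 2) = C * (b - a) ^ 2 / (n + 1) := by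
      rw [hδ]; push_cast; field_simp
    rwa [e1, e2] at this
  have hlim : Tendsto (fun n : ℕ => f a - C * (b - a) ^ 2 / ((n : ℝ) + 1)) atTop
      (𝓝 (f a - 0)) := by
    refine tendsto_const_nhds.sub ?_
    have := (tendsto_one_div_add_atTop_nhds_zero_nat (𝕜 := ℝ)).const_mul (C * (b - a) ^ 2)
    simpa [div_eq_mul_inv] using this
  rw [sub_zero] at hlim
  exact le_of_tendsto hlim (Eventually.of_forall key)

/-- A bounded solution of `i∂ₜu + Δu = N`, with `N` bounded in `L¹`, cannot have
`Re θ⟨N(s), e^{isΔ}ψ⟩ ≥ c/s` for all large `s`. -/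
theorem false_of_pairing_freeEvolution_ge {u : ℝ → LTwo d} {N : ℝ → Space d → ℂ} {T B c : ℝ}
    (hT : 0 < T) (hc : 0 < c) (hu : ∀ s, T ≤ s → ‖u s‖ ≤ B)
    (hN : ∀ᵐ s : ℝ, T ≤ s → Integrable (N s) ∧ ∫ x, ‖N s x‖ ≤ B)
    (hint : ∀ (φ : 𝓢(Space d, ℂ)) (a b : ℝ), T ≤ a → a ≤ b → IntervalIntegrable
      (fun s => -pairing (u s) (Δ φ : 𝓢(Space d, ℂ)) + pairing (N s) φ) volume a b)
    (heq : ∀ (φ : 𝓢(Space d, ℂ)) (a b : ℝ), T ≤ a → a ≤ b →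
      Complex.I * (pairing (u b) φ - pairing (u a) φ)
        = ∫ s in a..b, (-pairing (u s) (Δ φ : 𝓢(Space d, ℂ)) + pairing (N s) φ))
    (ψ : 𝓢(Space d, ℂ)) {θ : ℂ} (hθ : ‖θ‖ = 1)
    (hlow : ∀ᵐ s : ℝ, T ≤ s → c / s ≤ (θ * pairing (N s) (freeEvolution d s ψ)).re) :
    False := by
  have hB : 0 ≤ B := (norm_nonneg _).trans (hu T le_rfl)
  -- The pairing with a fixed test function is Lipschitz in time; this will control freezing `u` at
  -- the right endpoint.
  have hlip : ∀ (φ : 𝓢(Space d, ℂ)) (M : ℝ), (∀ x, ‖φ x‖ ≤ M) → ∀ a b, T ≤ a → a ≤ b →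
      ‖pairing (u b) φ - pairing (u a) φ‖
        ≤ (B * ‖(Δ φ : 𝓢(Space d, ℂ)).toLp 2 volume‖ + B * M) * (b - a) := by
    intro φ M hM a b ha hab
    have h1 : ‖pairing (u b) φ - pairing (u a) φ‖
        = ‖Complex.I * (pairing (u b) φ - pairing (u a) φ)‖ := by
      rw [norm_mul, Complex.norm_I, one_mul]
    have hM0 : 0 ≤ M := (norm_nonneg _).trans (hM 0)
    rw [h1, heq φ a b ha hab, ← abs_of_nonneg (sub_nonneg.2 hab)]
    refine intervalIntegral.norm_integral_le_of_norm_le_const_ae ?_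
    filter_upwards [hN] with s hs hsab
    rw [uIoc_of_le hab] at hsab
    have hTs : T ≤ s := ha.trans hsab.1.le
    refine (norm_add_le _ _).trans (add_le_add ?_ ?_)
    · rw [norm_neg]
      exact (norm_pairing_le _ _).trans (mul_le_mul_of_nonneg_right (hu s hTs) (norm_nonneg _))
    · exact (norm_pairing_le_of_norm_le (hs hTs).1 hM).trans
        (mul_le_mul_of_nonneg_right (hs hTs).2 hM0)
  set M₁ : ℝ := ∫ ξ, ‖𝓕 (Δ ψ : 𝓢(Space d, ℂ)) ξ‖ with hM₁
  set M₂ : ℝ := ‖(Δ (Δ ψ : 𝓢(Space d, ℂ)) : 𝓢(Space d, ℂ)).toLp 2 volume‖ with hM₂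
  set K : ℝ := (B * M₂ + B * M₁) + B * M₁ with hK
  set G : ℝ → ℂ := fun t => pairing (u t) (freeEvolution d t ψ) with hG
  -- `Re(θ i G) - c log t` is nondecreasing up to a quadratic defect, with a constant independent of
  -- the interval.
  have hstep : ∀ a b, T ≤ a → a ≤ b →
      ((θ * (Complex.I * G a)).re - c * Real.log a) - (K + B * (2 * M₂)) * (b - a) ^ 2
        ≤ (θ * (Complex.I * G b)).re - c * Real.log b := by
    intro a b ha hab
    have ha0 : 0 < a := hT.trans_le ha
    have hb0 : 0 < b := ha0.trans_le hab
    set ψa := freeEvolution d a ψ with hψa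
    set ψb := freeEvolution d b ψ with hψb
    set χ : 𝓢(Space d, ℂ) := Δ ψa with hχ
    set D : 𝓢(Space d, ℂ) := ψb - ψa - (Complex.I * ((b - a : ℝ) : ℂ)) • χ with hD
    set F : ℝ → ℂ := fun s => -pairing (u s) χ + pairing (N s) ψa with hF
    have hFint : IntervalIntegrable F volume a b := hint ψa a b ha hab
    have hcint : IntervalIntegrable (fun _ : ℝ => pairing (u b) χ) volume a b :=
      intervalIntegrable_const
    -- Write `ψb = ψa + i(b-a)Δψa + D`. The linear term contributes `(b-a)⟨u b, Δψa⟩`, which cancels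
    -- the Laplacian term of the equation for `ψa` up to the variation of `u` on `[a, b]`.
    have hexp : Complex.I * (G b - G a)
        = (∫ s in a..b, (F s + pairing (u b) χ)) + Complex.I * pairing (u b) D := by
      have e1 : pairing (u b) D = pairing (u b) ψb - pairing (u b) ψa
          - conj (Complex.I * ((b - a : ℝ) : ℂ)) * pairing (u b) χ := by
        rw [hD, pairing_sub_right, pairing_sub_right, pairing_smul_right]
      rw [intervalIntegral.integral_add hFint hcint, intervalIntegral.integral_const,
        ← heq ψa a b ha hab, e1, map_mul, Complex.conj_I, Complex.conj_ofReal, Complex.real_smul]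
      linear_combination (-(((b - a : ℝ) : ℂ)) * pairing (u b) χ) * Complex.I_mul_I
    have hDn : ‖θ * (Complex.I * pairing (u b) D)‖ ≤ B * (2 * M₂) * (b - a) ^ 2 := by
      rw [norm_mul, norm_mul, hθ, Complex.norm_I, one_mul, one_mul]
      calc _ ≤ ‖u b‖ * ‖D.toLp 2 volume‖ := norm_pairing_le _ _
        _ ≤ B * (2 * (b - a) ^ 2 * M₂) :=
          mul_le_mul (hu b (ha.trans hab)) (norm_toLp_freeEvolution_taylor_le a b ψ)
            (norm_nonneg _) hB
        _ = _ := by ring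
    have hre : (θ * ∫ s in a..b, (F s + pairing (u b) χ)).re
        = ∫ s in a..b, (θ * (F s + pairing (u b) χ)).re := by
      rw [← intervalIntegral.integral_const_mul]
      exact (Complex.reCLM.intervalIntegral_comp_comm ((hFint.add hcint).const_mul θ)).symm
    have hinv : IntervalIntegrable (fun s : ℝ => c / s) volume a b := by
      simp only [div_eq_mul_inv]
      refine (intervalIntegral.intervalIntegrable_inv (fun x hx => ?_)
        continuousOn_id).const_mul c
      rw [uIcc_of_le hab] at hx
      exact (ha0.trans_le hx.1).ne'
    have hlower : ∫ s in a..b, (c / s - K * (b - a)) ≤ ∫ s in a..b, (θ * (F s + pairing (u b) χ)).re := by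
      refine intervalIntegral.integral_mono_ae_restrict hab (hinv.sub intervalIntegrable_const)
        ⟨((hFint.add hcint).const_mul θ).1.re, ((hFint.add hcint).const_mul θ).2.re⟩ ?_
      rw [EventuallyLE, ae_restrict_iff' measurableSet_Icc]
      filter_upwards [hN, hlow] with s hNs hls hsab
      have hTs : T ≤ s := ha.trans hsab.1
      obtain ⟨hNi, hNB⟩ := hNs hTs
      have hχM : ∀ x, ‖χ x‖ ≤ M₁ := by
        intro x
        rw [hχ, hψa, laplacian_freeEvolution]
        exact norm_freeEvolution_apply_le a _ x
      have hΔχ : ‖(Δ χ : 𝓢(Space d, ℂ)).toLp 2 volume‖ ≤ M₂ := by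
        rw [hχ, hψa, laplacian_freeEvolution, laplacian_freeEvolution]
        exact norm_toLp_freeEvolution_le a _
      have hM₁0 : 0 ≤ M₁ := (norm_nonneg _).trans (hχM 0)
      have h1 : ‖θ * (pairing (u b) χ - pairing (u s) χ)‖ ≤ (B * M₂ + B * M₁) * (b - a) := by
        rw [norm_mul, hθ, one_mul]
        refine (hlip χ M₁ hχM s b hTs hsab.2).trans ?_
        have : b - s ≤ b - a := by linarith [hsab.1]
        refine mul_le_mul ?_ this (by linarith [hsab.2]) ?_
        · linarith [mul_le_mul_of_nonneg_left hΔχ hB]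
        · have := norm_nonneg ((Δ (Δ ψ : 𝓢(Space d, ℂ)) : 𝓢(Space d, ℂ)).toLp 2 volume)
          exact add_nonneg (mul_nonneg hB this) (mul_nonneg hB hM₁0)
      have h2 : ‖θ * (pairing (N s) ψa - pairing (N s) (freeEvolution d s ψ))‖
          ≤ B * M₁ * (b - a) := by
        rw [norm_mul, hθ, one_mul, ← pairing_sub_right_of_integrable hNi]
        have hsup : ∀ x, ‖(ψa - freeEvolution d s ψ) x‖ ≤ (b - a) * M₁ := by
          intro x
          refine (norm_freeEvolution_sub_apply_le s a ψ x).trans ?_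
          refine mul_le_mul_of_nonneg_right ?_ hM₁0
          rw [abs_of_nonpos (by linarith [hsab.1])]
          linarith [hsab.2]
        refine (norm_pairing_le_of_norm_le hNi hsup).trans ?_
        have h0 : 0 ≤ (b - a) * M₁ := mul_nonneg (sub_nonneg.2 hab) hM₁0
        linarith [mul_le_mul_of_nonneg_right hNB h0]
      have h3 : θ * (F s + pairing (u b) χ) = θ * pairing (N s) (freeEvolution d s ψ)
          + θ * (pairing (u b) χ - pairing (u s) χ)
          + θ * (pairing (N s) ψa - pairing (N s) (freeEvolution d s ψ)) := by
        rw [hF]; ring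
      rw [h3, Complex.add_re, Complex.add_re]
      have h4 := (abs_le.1 ((Complex.abs_re_le_norm _).trans h1)).1
      have h5 := (abs_le.1 ((Complex.abs_re_le_norm _).trans h2)).1
      have h6 := hls hTs
      rw [hK]
      linarith
    have hlog : ∫ s in a..b, (c / s - K * (b - a))
        = c * (Real.log b - Real.log a) - K * (b - a) ^ 2 := by
      rw [intervalIntegral.integral_sub hinv intervalIntegrable_const,
        intervalIntegral.integral_const]
      simp only [div_eq_mul_inv]
      rw [intervalIntegral.integral_const_mul, integral_inv_of_pos ha0 hb0,
        Real.log_div hb0.ne' ha0.ne', smul_eq_mul]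
      ring
    have hfin : (θ * (Complex.I * G b)).re - (θ * (Complex.I * G a)).re
        = (θ * ∫ s in a..b, (F s + pairing (u b) χ)).re
          + (θ * (Complex.I * pairing (u b) D)).re := by
      rw [← Complex.sub_re, ← Complex.add_re, ← mul_add, ← hexp]
      congr 1
      ring
    have hDr := (abs_le.1 ((Complex.abs_re_le_norm _).trans hDn)).1
    rw [hlog, ← hre] at hlower
    nlinarith
  have hmono := fun b (hb : T ≤ b) => le_of_forall_sub_sq_le hstep le_rfl hb
  have hGb : ∀ t, T ≤ t → |(θ * (Complex.I * G t)).re| ≤ B * ‖ψ.toLp 2 volume‖ := by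
    intro t ht
    refine (Complex.abs_re_le_norm _).trans ?_
    rw [norm_mul, norm_mul, hθ, Complex.norm_I, one_mul, one_mul]
    exact (norm_pairing_le _ _).trans (mul_le_mul (hu t ht) (norm_toLp_freeEvolution_le t ψ)
      (norm_nonneg _) hB)
  -- Monotonicity from `T` to `b` makes `c log b` bounded, since `G` is; a large `b` violates this.
  obtain ⟨b, hb, hTb⟩ := ((Real.tendsto_log_atTop.const_mul_atTop hc).eventually_gt_atTop
    (2 * (B * ‖ψ.toLp 2 volume‖) + c * Real.log T)).and (eventually_ge_atTop T) |>.exists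
  have h1 := hmono b hTb
  have h2 := (abs_le.1 (hGb T le_rfl)).1
  have h3 := (abs_le.1 (hGb b hTb)).2
  linarith

/-! ### Choice of the test function -/

lemma mutuallySingular_map_smul {ν : Measure (Space d)}
    (hν : ν ⟂ₘ (volume : Measure (Space d))) {c : ℝ} (hc : c ≠ 0) :
    ν.map (fun x => c • x) ⟂ₘ (volume : Measure (Space d)) := by
  have hm : Measurable (fun x : Space d => c⁻¹ • x) := by fun_prop
  have hm' : Measurable (fun x : Space d => c • x) := by fun_prop
  refine ⟨(fun x => c⁻¹ • x) ⁻¹' hν.nullSet, hm hν.measurableSet_nullSet, ?_, ?_⟩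
  · rw [Measure.map_apply hm' (hm hν.measurableSet_nullSet), ← preimage_comp]
    have : ((fun x : Space d => c⁻¹ • x) ∘ fun x => c • x) = id := by
      funext x
      simp [smul_smul, inv_mul_cancel₀ hc]
    rw [this, preimage_id, hν.measure_nullSet]
  · rw [← preimage_compl]
    exact (Measure.quasiMeasurePreserving_smul (volume : Measure (Space d))
      (inv_ne_zero hc)).preimage_null hν.measure_compl_nullSet

lemma integral_norm_sq_eq (w : LTwo d) : ∫ x, ‖w x‖ ^ 2 = ‖w‖ ^ 2 := by
  have h := L2.inner_def (𝕜 := ℂ) w w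
  rw [inner_self_eq_norm_sq_to_K] at h
  have h2 : ∀ x, inner ℂ (w x) (w x) = ((‖w x‖ ^ 2 : ℝ) : ℂ) := by
    intro x
    rw [inner_self_eq_norm_sq_to_K]
    norm_cast
  simp_rw [h2] at h
  apply Complex.ofReal_injective
  rw [Complex.ofReal_pow]
  exact (h.trans integral_complex_ofReal).symm

lemma lintegral_enorm_sq_eq (w : LTwo d) : ∫⁻ x, ‖w x‖ₑ ^ 2 = ENNReal.ofReal (‖w‖ ^ 2) := by
  rw [← integral_norm_sq_eq, ofReal_integral_eq_lintegral_ofReal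
    ((memLp_two_iff_integrable_sq_norm (Lp.aestronglyMeasurable w)).1 (Lp.memLp w))
    (Eventually.of_forall fun x => by positivity)]
  refine lintegral_congr fun x => ?_
  rw [ENNReal.ofReal_pow (norm_nonneg _), ofReal_norm]

/-- There are Schwartz functions that are close to `w/|w|` in the weighted space `L¹(|w|²dx)`, and
nearly vanish with respect to a singular measure. -/
theorem exists_schwartz_approx_phase (w : LTwo d) (ν : Measure (Space d)) [IsFiniteMeasure ν]
    (hν : ν ⟂ₘ (volume : Measure (Space d))) {ε : ℝ} (hε : 0 < ε) :
    ∃ g : 𝓢(Space d, ℂ),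
      ‖(∫ x, (‖w x‖ : ℂ) * w x * conj (g x)) - ((‖w‖ ^ 2 : ℝ) : ℂ)‖ ≤ ε ∧
      ∫⁻ x, ‖g x‖ₑ ∂ν ≤ ENNReal.ofReal ε ∧
      ∫⁻ x, ‖w x‖ₑ ^ 2 * ‖g x‖ₑ ≤ ENNReal.ofReal (‖w‖ ^ 2 + ε) := by
  have hwm : Measurable fun x => ‖w x‖ₑ ^ 2 := (Lp.stronglyMeasurable w).enorm.pow_const 2
  set ρ : Measure (Space d) := volume.withDensity (fun x => ‖w x‖ₑ ^ 2) with hρ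
  have : IsFiniteMeasure ρ := isFiniteMeasure_withDensity (by
    rw [lintegral_enorm_sq_eq]; exact ENNReal.ofReal_ne_top)
  set S := hν.nullSet with hS
  have hSm : MeasurableSet S := hν.measurableSet_nullSet
  -- `S` is `ν`-null and Lebesgue-conull, so `g₀` is the phase of `w` for one measure and zero for
  -- the other.
  set g₀ : Space d → ℂ := S.indicator (fun x => w x / (‖w x‖ : ℂ)) with hg₀
  have hg₀m : Measurable g₀ :=
    ((Lp.stronglyMeasurable w).measurable.div
      (Complex.measurable_ofReal.comp (Lp.stronglyMeasurable w).norm.measurable)).indicator hSm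
  have hg₀n : ∀ x, ‖g₀ x‖ ≤ 1 := by
    intro x
    refine (norm_indicator_le_norm_self _ x).trans ?_
    rw [norm_div, Complex.norm_real, norm_norm]
    exact div_self_le_one _
  have hg₀L : MemLp g₀ 1 (ρ + ν) :=
    MemLp.of_bound hg₀m.aestronglyMeasurable 1 (Eventually.of_forall hg₀n)
  -- One approximation in `L¹(ρ + ν)`, with `ρ = |w|²dx`, gives all three estimates.
  obtain ⟨g, hg⟩ : ∃ g : 𝓢(Space d, ℂ), eLpNorm (g₀ - ⇑g) 1 (ρ + ν) ≤ ENNReal.ofReal ε := by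
    obtain ⟨g, hg⟩ := (SchwartzMap.denseRange_toLpCLM (E := Space d) (F := ℂ) (p := 1)
      (μ := ρ + ν) ENNReal.one_ne_top).exists_dist_lt (hg₀L.toLp g₀) hε
    refine ⟨g, ?_⟩
    have h1 : edist (hg₀L.toLp g₀) (g.toLp 1 (ρ + ν)) ≤ ENNReal.ofReal ε := by
      rw [edist_dist]
      exact ENNReal.ofReal_le_ofReal hg.le
    rwa [SchwartzMap.toLp, Lp.edist_toLp_toLp] at h1
  rw [eLpNorm_one_eq_lintegral_enorm, lintegral_add_measure, hρ,
    lintegral_withDensity_eq_lintegral_mul₀ hwm.aemeasurable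
      ((hg₀m.sub g.continuous.measurable).enorm.aemeasurable)] at hg
  simp only [Pi.mul_apply, Pi.sub_apply] at hg
  have hg1 := le_self_add.trans hg
  have hg2 := le_add_self.trans hg
  have hSvol : ∀ᵐ x : Space d, x ∈ S := by
    rw [ae_iff]
    exact hν.measure_compl_nullSet
  have hSν : ∀ᵐ x ∂ν, x ∉ S := by
    rw [ae_iff]
    simp only [not_not]
    exact hν.measure_nullSet
  refine ⟨g, ?_, ?_, ?_⟩
  · have hwsq : Integrable (fun x => ‖w x‖ ^ 2) :=
      (memLp_two_iff_integrable_sq_norm (Lp.aestronglyMeasurable w)).1 (Lp.memLp w)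
    have hbase : AEStronglyMeasurable (fun x => (‖w x‖ : ℂ) * w x) volume :=
      (Complex.continuous_ofReal.comp_aestronglyMeasurable
        (Lp.aestronglyMeasurable w).norm).mul (Lp.aestronglyMeasurable w)
    have hbaseI : Integrable (fun x => (‖w x‖ : ℂ) * w x) := by
      refine hwsq.mono' hbase (Eventually.of_forall fun x => ?_)
      rw [norm_mul, Complex.norm_real, norm_norm, sq]
    have hI1 := integrable_mul_conj_schwartz hbaseI g
    have heq : ((‖w‖ ^ 2 : ℝ) : ℂ) = ∫ x, (‖w x‖ : ℂ) * w x * conj (g₀ x) := by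
      rw [← integral_norm_sq_eq, ← integral_complex_ofReal]
      refine integral_congr_ae ?_
      filter_upwards [hSvol] with x hx
      rw [hg₀, indicator_of_mem hx, map_div₀, Complex.conj_ofReal]
      rcases eq_or_ne (w x) 0 with h0 | h0
      · simp [h0]
      · have hn : (‖w x‖ : ℂ) ≠ 0 := by exact_mod_cast norm_ne_zero_iff.2 h0
        field_simp
        rw [RCLike.mul_conj]
        norm_cast
    have hI2 : Integrable fun x => (‖w x‖ : ℂ) * w x * conj (g₀ x) := by
      refine hbaseI.mul_bdd (c := 1)
        (Complex.continuous_conj.measurable.comp hg₀m).aestronglyMeasurable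
        (Eventually.of_forall fun x => ?_)
      rw [RCLike.norm_conj]
      exact hg₀n x
    rw [heq, ← integral_sub hI1 hI2]
    have h := enorm_integral_le_lintegral_enorm (μ := volume)
      (fun x => (‖w x‖ : ℂ) * w x * conj (g x) - (‖w x‖ : ℂ) * w x * conj (g₀ x))
    have h2 : ∀ x, ‖(‖w x‖ : ℂ) * w x * conj (g x) - (‖w x‖ : ℂ) * w x * conj (g₀ x)‖ₑ
        = ‖w x‖ₑ ^ 2 * ‖g₀ x - g x‖ₑ := by
      intro x
      rw [← mul_sub, ← map_sub, ← ofReal_norm, norm_mul, RCLike.norm_conj, norm_mul,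
        Complex.norm_real, norm_norm, norm_sub_rev, ← sq, ENNReal.ofReal_mul (by positivity),
        ENNReal.ofReal_pow (norm_nonneg _), ofReal_norm, ofReal_norm]
    simp_rw [h2] at h
    have h3 := h.trans hg1
    rw [← ofReal_norm] at h3
    exact (ENNReal.ofReal_le_ofReal_iff hε.le).1 h3
  · refine le_trans (le_of_eq ?_) hg2
    refine lintegral_congr_ae ?_
    filter_upwards [hSν] with x hx
    rw [hg₀, indicator_of_notMem hx, zero_sub, enorm_neg]
  · rw [ENNReal.ofReal_add (by positivity) hε.le, ← lintegral_enorm_sq_eq]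
    calc ∫⁻ x, ‖w x‖ₑ ^ 2 * ‖g x‖ₑ
        ≤ ∫⁻ x, (‖w x‖ₑ ^ 2 + ‖w x‖ₑ ^ 2 * ‖g₀ x - g x‖ₑ) := by
          refine lintegral_mono fun x => ?_
          have h1 : ‖g x‖ₑ ≤ 1 + ‖g₀ x - g x‖ₑ := by
            have h2 : ‖g₀ x‖ₑ ≤ 1 := by
              rw [← ofReal_norm, ← ENNReal.ofReal_one]
              exact ENNReal.ofReal_le_ofReal (hg₀n x)
            calc ‖g x‖ₑ = ‖g₀ x - (g₀ x - g x)‖ₑ := by rw [sub_sub_cancel]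
              _ ≤ ‖g₀ x‖ₑ + ‖g₀ x - g x‖ₑ := enorm_sub_le
              _ ≤ _ := by gcongr
          calc _ ≤ ‖w x‖ₑ ^ 2 * (1 + ‖g₀ x - g x‖ₑ) := by gcongr
            _ = _ := by rw [mul_add, mul_one]
      _ = (∫⁻ x, ‖w x‖ₑ ^ 2) + ∫⁻ x, ‖w x‖ₑ ^ 2 * ‖g₀ x - g x‖ₑ := lintegral_add_left hwm _
      _ ≤ _ := by gcongr

/-! ### Scaling identities for the profile -/

/-- The kernel phase cancels against its conjugate, leaving three powers of the amplitude; the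
change of variables absorbs two of them. -/
lemma integral_powerNonlinearity_profile {t : ℝ} (ht : 0 < t) (μ : ℂ) (w g : Space d → ℂ) :
    ∫ x, powerNonlinearity μ 1 (profile t w x) * conj (profile t g x)
      = (decayRate d t : ℂ) * (μ * ∫ x, (‖w x‖ : ℂ) * w x * conj (g x)) := by
  have hpi := Real.pi_pos
  have h : ∀ x : Space d, powerNonlinearity μ 1 (profile t w x) * conj (profile t g x)
      = ((decayRate d t : ℂ) ^ 3 * μ) * (fun y => (‖w y‖ : ℂ) * w y * conj (g y))
        ((4 * Real.pi * t)⁻¹ • x) := by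
    intro x
    have hk : kernelFactor d t x * conj (kernelFactor d t x) = (decayRate d t : ℂ) ^ 2 := by
      rw [RCLike.mul_conj, norm_kernelFactor ht]
      rfl
    rw [powerNonlinearity, Real.rpow_one, norm_profile ht]
    simp only [profile, map_mul]
    push_cast
    linear_combination (μ * (decayRate d t : ℂ) * (‖w ((4 * Real.pi * t)⁻¹ • x)‖ : ℂ)
      * w ((4 * Real.pi * t)⁻¹ • x) * conj (g ((4 * Real.pi * t)⁻¹ • x))) * hk
  simp_rw [h]
  rw [integral_const_mul, Measure.integral_comp_smul volume
    (fun y => (‖w y‖ : ℂ) * w y * conj (g y)) (4 * Real.pi * t)⁻¹, finrank_euclideanSpace_fin,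
    abs_of_pos (by positivity), inv_pow, inv_inv, Complex.real_smul]
  have hs : ((decayRate d t : ℂ) ^ 2 * (((4 * Real.pi * t) ^ d : ℝ) : ℂ)) = 1 := by
    rw [← Complex.ofReal_pow, ← Complex.ofReal_mul, decayRate_sq_mul ht, Complex.ofReal_one]
  linear_combination ((decayRate d t : ℂ) * μ * ∫ x, (‖w x‖ : ℂ) * w x * conj (g x)) * hs

lemma enorm_profile {t : ℝ} (ht : 0 < t) (w : Space d → ℂ) (x : Space d) :
    ‖profile t w x‖ₑ = ENNReal.ofReal (decayRate d t) * ‖w ((4 * Real.pi * t)⁻¹ • x)‖ₑ := by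
  rw [← ofReal_norm, norm_profile ht, ENNReal.ofReal_mul (decayRate_pos ht).le, ofReal_norm]

lemma lintegral_profile_sq_mul_profile {t : ℝ} (ht : 0 < t) (w g : Space d → ℂ) :
    ∫⁻ x, ‖profile t w x‖ₑ ^ 2 * ‖profile t g x‖ₑ
      = ENNReal.ofReal (decayRate d t) * ∫⁻ x, ‖w x‖ₑ ^ 2 * ‖g x‖ₑ := by
  have hpi := Real.pi_pos
  have h : ∀ x : Space d, ‖profile t w x‖ₑ ^ 2 * ‖profile t g x‖ₑ
      = ENNReal.ofReal (decayRate d t) ^ 3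
        * (fun y => ‖w y‖ₑ ^ 2 * ‖g y‖ₑ) ((4 * Real.pi * t)⁻¹ • x) := by
    intro x
    rw [enorm_profile ht, enorm_profile ht]
    ring
  simp_rw [h]
  rw [lintegral_const_mul' _ _ (by finiteness),
    lintegral_comp_smul_space (fun y => ‖w y‖ₑ ^ 2 * ‖g y‖ₑ) (r := (4 * Real.pi * t)⁻¹)
      (by positivity), ← mul_assoc, pow_succ', mul_assoc (ENNReal.ofReal (decayRate d t)),
    ← ENNReal.ofReal_pow (decayRate_pos ht).le, ofReal_decayRate_sq_mul ht, mul_one]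

/-- The profile lives at `x/(4πt)` and the rescaled mass at `x/t`; the mismatch is the dilation by
`(4π)⁻¹` of `g`. -/
lemma lintegral_mul_profile_eq_rescaledMass {t : ℝ} (ht : 0 < t) (l V : ℝ → Space d → ℂ)
    (g : Space d → ℂ) :
    ∫⁻ x, (‖l t x‖ₑ ^ 2 + ‖V t x‖ₑ ^ 2) * ‖profile t g x‖ₑ
      = ENNReal.ofReal (decayRate d t)
        * rescaledMass l V (fun x => ‖g ((4 * Real.pi)⁻¹ • x)‖) t := by
  have hpi := Real.pi_pos
  have h1 : ∀ x : Space d, ENNReal.ofReal (t ^ d * (‖l t (t • x)‖ ^ 2 + ‖V t (t • x)‖ ^ 2)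
        * ‖g ((4 * Real.pi)⁻¹ • x)‖)
      = ENNReal.ofReal (t ^ d) * (fun y => (‖l t y‖ₑ ^ 2 + ‖V t y‖ₑ ^ 2)
        * ‖g ((4 * Real.pi * t)⁻¹ • y)‖ₑ) (t • x) := by
    intro x
    have hx : (4 * Real.pi * t)⁻¹ • t • x = (4 * Real.pi)⁻¹ • x := by
      rw [smul_smul]
      congr 1
      field_simp
    simp only [hx]
    rw [ENNReal.ofReal_mul (by positivity), ENNReal.ofReal_mul (by positivity),
      ENNReal.ofReal_add (by positivity) (by positivity), ENNReal.ofReal_pow (norm_nonneg _),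
      ENNReal.ofReal_pow (norm_nonneg _), ofReal_norm, ofReal_norm, ofReal_norm, mul_assoc]
  have h2 : rescaledMass l V (fun x => ‖g ((4 * Real.pi)⁻¹ • x)‖) t
      = ∫⁻ y, (‖l t y‖ₑ ^ 2 + ‖V t y‖ₑ ^ 2) * ‖g ((4 * Real.pi * t)⁻¹ • y)‖ₑ := by
    unfold rescaledMass
    simp_rw [h1]
    rw [lintegral_const_mul' _ _ ENNReal.ofReal_ne_top,
      lintegral_comp_smul_space (fun y => (‖l t y‖ₑ ^ 2 + ‖V t y‖ₑ ^ 2)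
        * ‖g ((4 * Real.pi * t)⁻¹ • y)‖ₑ) ht, ← mul_assoc, ← ENNReal.ofReal_mul (by positivity),
      mul_inv_cancel₀ (by positivity), ENNReal.ofReal_one, one_mul]
  rw [h2, ← lintegral_const_mul' _ _ ENNReal.ofReal_ne_top]
  refine lintegral_congr fun x => ?_
  rw [enorm_profile ht]
  ring

lemma lintegral_sq_mul_profile_le {t : ℝ} (ht : 0 < t) (r g : Space d → ℂ) {M : ℝ}
    (hM : ∀ x, ‖g x‖ ≤ M) :
    ∫⁻ x, ‖r x‖ₑ ^ 2 * ‖profile t g x‖ₑ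
      ≤ ENNReal.ofReal (decayRate d t) * (ENNReal.ofReal M * eLpNorm r 2 volume ^ 2) := by
  have h2 : eLpNorm r 2 volume ^ 2 = ∫⁻ x, ‖r x‖ₑ ^ 2 := by
    rw [eLpNorm_eq_lintegral_rpow_enorm_toReal two_ne_zero ENNReal.ofNat_ne_top,
      ← ENNReal.rpow_natCast, ← ENNReal.rpow_mul]
    norm_num
  rw [h2, ← mul_assoc, ← lintegral_const_mul' _ _ (by finiteness)]
  refine lintegral_mono fun x => ?_
  rw [enorm_profile ht, mul_comm]
  gcongr
  rw [← ofReal_norm]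
  exact ENNReal.ofReal_le_ofReal (hM _)

/-! ### The nonlinear term -/

lemma norm_powerNonlinearity_one (μ z : ℂ) : ‖powerNonlinearity μ 1 z‖ = ‖μ‖ * ‖z‖ ^ 2 := by
  rw [powerNonlinearity, Real.rpow_one, norm_mul, norm_mul, Complex.norm_real, norm_norm]
  ring

lemma norm_powerNonlinearity_one_sub_le (μ z w : ℂ) :
    ‖powerNonlinearity μ 1 z - powerNonlinearity μ 1 w‖ ≤ ‖μ‖ * ((‖z‖ + ‖w‖) * ‖z - w‖) := by
  have h : powerNonlinearity μ 1 z - powerNonlinearity μ 1 w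
      = μ * ((‖z‖ : ℂ) * (z - w) + ((‖z‖ - ‖w‖ : ℝ) : ℂ) * w) := by
    rw [powerNonlinearity, powerNonlinearity, Real.rpow_one, Real.rpow_one]
    push_cast
    ring
  rw [h, norm_mul]
  refine mul_le_mul_of_nonneg_left ((norm_add_le _ _).trans ?_) (norm_nonneg _)
  rw [norm_mul, norm_mul, Complex.norm_real, Complex.norm_real, norm_norm, Real.norm_eq_abs]
  have := mul_le_mul_of_nonneg_right (abs_norm_sub_norm_le z w) (norm_nonneg w)
  linarith

/-- The nonlinear term differs from that of the profile by terms quadratic in the potential, the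
localized part and the remainder, up to a small multiple of the mass of the profile. -/
lemma norm_forcing_sub_le {δ : ℝ} (hδ : 0 < δ) (hδ1 : δ ≤ 1) (μ V u l W : ℂ) :
    ‖V * u + powerNonlinearity μ 1 u - powerNonlinearity μ 1 W‖
      ≤ (2 + 4 * ‖μ‖) * δ * ‖W‖ ^ 2 + (2 + 4 * ‖μ‖) * δ⁻¹ * (‖l‖ ^ 2 + ‖V‖ ^ 2)
        + (2 + 4 * ‖μ‖) * δ⁻¹ * ‖u - l - W‖ ^ 2 := by
  set r := u - l - W with hr
  have hu : ‖u‖ ≤ ‖W‖ + ‖l‖ + ‖r‖ := by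
    have : u = W + l + r := by rw [hr]; ring
    rw [this]
    exact norm_add₃_le
  have huW : ‖u - W‖ ≤ ‖l‖ + ‖r‖ := by
    have : u - W = l + r := by rw [hr]; ring
    rw [this]
    exact norm_add_le _ _
  have hinv : 1 ≤ δ⁻¹ := (one_le_inv₀ hδ).2 hδ1
  -- Cross terms with the profile put the small weight on `|W|²`; all others absorb `δ⁻¹ ≥ 1`.
  have young : ∀ x y : ℝ, 2 * (x * y) ≤ δ * x ^ 2 + δ⁻¹ * y ^ 2 := by
    intro x y
    have h : δ * x ^ 2 + δ⁻¹ * y ^ 2 - 2 * (x * y) = δ * (x - δ⁻¹ * y) ^ 2 := by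
      field_simp
      ring
    have : 0 ≤ δ * (x - δ⁻¹ * y) ^ 2 := by positivity
    linarith
  have up : ∀ y : ℝ, y ^ 2 ≤ δ⁻¹ * y ^ 2 := fun y => le_mul_of_one_le_left (sq_nonneg y) hinv
  have hV : ‖V‖ * ‖u‖ ≤ 2 * (δ * ‖W‖ ^ 2 + δ⁻¹ * (‖l‖ ^ 2 + ‖V‖ ^ 2) + δ⁻¹ * ‖r‖ ^ 2) := by
    have h1 := mul_le_mul_of_nonneg_left hu (norm_nonneg V)
    have h2 := young ‖W‖ ‖V‖
    nlinarith [sq_nonneg (‖V‖ - ‖l‖), sq_nonneg (‖V‖ - ‖r‖), up ‖V‖, up ‖l‖, up ‖r‖,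
      mul_nonneg hδ.le (sq_nonneg ‖W‖)]
  have hF : (‖u‖ + ‖W‖) * ‖u - W‖
      ≤ 4 * (δ * ‖W‖ ^ 2 + δ⁻¹ * (‖l‖ ^ 2 + ‖V‖ ^ 2) + δ⁻¹ * ‖r‖ ^ 2) := by
    have h1 : (‖u‖ + ‖W‖) * ‖u - W‖ ≤ (2 * ‖W‖ + (‖l‖ + ‖r‖)) * (‖l‖ + ‖r‖) :=
      mul_le_mul (by linarith) huW (norm_nonneg _) (by positivity)
    have h2 := young ‖W‖ (‖l‖ + ‖r‖)
    have h3 := up (‖l‖ + ‖r‖)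
    have h4 : δ⁻¹ * (‖l‖ + ‖r‖) ^ 2 ≤ δ⁻¹ * (2 * ‖l‖ ^ 2 + 2 * ‖r‖ ^ 2) :=
      mul_le_mul_of_nonneg_left (by nlinarith [sq_nonneg (‖l‖ - ‖r‖)]) (by positivity)
    have h5 : 0 ≤ δ⁻¹ * ‖V‖ ^ 2 := by positivity
    nlinarith [mul_nonneg hδ.le (sq_nonneg ‖W‖)]
  have h := norm_add_le (V * u) (powerNonlinearity μ 1 u - powerNonlinearity μ 1 W)
  rw [← add_sub_assoc, norm_mul] at h
  have h2 := (norm_powerNonlinearity_one_sub_le μ u W).trans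
    (mul_le_mul_of_nonneg_left hF (norm_nonneg μ))
  nlinarith

lemma integrable_powerNonlinearity_one (μ : ℂ) {f : Space d → ℂ} (hf : MemLp f 2 volume) :
    Integrable fun x => powerNonlinearity μ 1 (f x) := by
  have hm : AEStronglyMeasurable (fun x => powerNonlinearity μ 1 (f x)) volume := by
    have : Continuous (powerNonlinearity μ 1) := by
      unfold powerNonlinearity
      simp only [Real.rpow_one]
      fun_prop
    exact this.comp_aestronglyMeasurable hf.1
  refine (((memLp_two_iff_integrable_sq_norm hf.1).1 hf).const_mul ‖μ‖).mono' hm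
    (Eventually.of_forall fun x => (norm_powerNonlinearity_one μ _).le)

lemma integral_norm_sq_le_of_eLpNorm_le {f : Space d → ℂ} (hf : MemLp f 2 volume) {C : ℝ}
    (hC : 0 ≤ C) (h : eLpNorm f 2 volume ≤ ENNReal.ofReal C) : ∫ x, ‖f x‖ ^ 2 ≤ C ^ 2 := by
  have h1 : ∫ x, ‖f x‖ ^ 2 = ‖hf.toLp f‖ ^ 2 := by
    rw [← integral_norm_sq_eq]
    refine integral_congr_ae ?_
    filter_upwards [hf.coeFn_toLp] with x hx
    rw [hx]
  rw [h1, Lp.norm_toLp]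
  refine pow_le_pow_left₀ ENNReal.toReal_nonneg ?_ 2
  exact ENNReal.toReal_le_of_le_ofReal hC h

/-- The forcing term `Vu + μ|u|u`. -/
def forcing (μ : ℂ) (V u : Space d → ℂ) (x : Space d) : ℂ :=
  V x * u x + powerNonlinearity μ 1 (u x)

lemma integrable_forcing (μ : ℂ) {V : Space d → ℂ} (hV : MemLp V 2 volume) (u : LTwo d) :
    Integrable (forcing μ V u) :=
  (hV.integrable_mul (Lp.memLp u)).add (integrable_powerNonlinearity_one μ (Lp.memLp u))

lemma integral_norm_forcing_le (μ : ℂ) {V : Space d → ℂ} (hV : MemLp V 2 volume) (u : LTwo d)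
    {C : ℝ} (hC : 0 ≤ C) (h : eLpNorm V 2 volume ≤ ENNReal.ofReal C) :
    ∫ x, ‖forcing μ V u x‖ ≤ C ^ 2 + (1 + ‖μ‖) * ‖u‖ ^ 2 := by
  have hVs := (memLp_two_iff_integrable_sq_norm hV.1).1 hV
  have hus := (memLp_two_iff_integrable_sq_norm (Lp.aestronglyMeasurable u)).1 (Lp.memLp u)
  calc ∫ x, ‖forcing μ V u x‖ ≤ ∫ x, (‖V x‖ ^ 2 + (1 + ‖μ‖) * ‖u x‖ ^ 2) := by
        refine integral_mono (integrable_forcing μ hV u).norm (hVs.add (hus.const_mul _))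
          fun x => ?_
        refine (norm_add_le _ _).trans ?_
        rw [norm_mul, norm_powerNonlinearity_one]
        nlinarith [sq_nonneg (‖V x‖ - ‖u x‖), sq_nonneg ‖V x‖, sq_nonneg ‖u x‖]
    _ = (∫ x, ‖V x‖ ^ 2) + (1 + ‖μ‖) * ∫ x, ‖u x‖ ^ 2 := by
        rw [integral_add hVs (hus.const_mul _), integral_const_mul]
    _ ≤ _ := by
        rw [integral_norm_sq_eq]
        linarith [integral_norm_sq_le_of_eLpNorm_le hV hC h]

/-- Integrating the pointwise bound `norm_forcing_sub_le` against the modulus of the profile of `g`,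
each of the three terms scales like the main term; `P`, `Q` and `R` bound what remains after
removing `decayRate d t`. -/
lemma norm_integral_forcing_sub_le {t δ : ℝ} (ht : 0 < t) (hδ : 0 < δ) (hδ1 : δ ≤ 1) (μ : ℂ)
    {V l : ℝ → Space d → ℂ} (hV : MemLp (V t) 2 volume) (hl : MemLp (l t) 2 volume)
    (u w : LTwo d) (g : 𝓢(Space d, ℂ)) {M P Q R : ℝ} (hM : ∀ x, ‖g x‖ ≤ M)
    (hP0 : 0 ≤ P) (hQ0 : 0 ≤ Q) (hR0 : 0 ≤ R)
    (hP : ∫⁻ x, ‖w x‖ₑ ^ 2 * ‖g x‖ₑ ≤ ENNReal.ofReal P)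
    (hQ : rescaledMass l V (fun x => ‖g ((4 * Real.pi)⁻¹ • x)‖) t ≤ ENNReal.ofReal Q)
    (hR : ENNReal.ofReal M * eLpNorm (fun x => u x - l t x - profile t w x) 2 volume ^ 2
      ≤ ENNReal.ofReal R) :
    ‖∫ x, (forcing μ (V t) u x - powerNonlinearity μ 1 (profile t w x)) * conj (profile t g x)‖
      ≤ decayRate d t * ((2 + 4 * ‖μ‖) * (δ * P + δ⁻¹ * (Q + R))) := by
  set κ : ℝ := 2 + 4 * ‖μ‖ with hκ
  have hκ0 : 0 ≤ κ := by positivity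
  have hρ := decayRate_pos (d := d) ht
  set c₁ : ℝ≥0∞ := ENNReal.ofReal (κ * δ) with hc₁
  set c₂ : ℝ≥0∞ := ENNReal.ofReal (κ * δ⁻¹) with hc₂
  have hpt : ∀ x, ‖(forcing μ (V t) u x - powerNonlinearity μ 1 (profile t w x))
        * conj (profile t g x)‖ₑ
      ≤ c₁ * (‖profile t w x‖ₑ ^ 2 * ‖profile t g x‖ₑ)
        + c₂ * ((‖l t x‖ₑ ^ 2 + ‖V t x‖ₑ ^ 2) * ‖profile t g x‖ₑ)
        + c₂ * (‖u x - l t x - profile t w x‖ₑ ^ 2 * ‖profile t g x‖ₑ) := by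
    intro x
    have h := ENNReal.ofReal_le_ofReal
      (norm_forcing_sub_le hδ hδ1 μ (V t x) (u x) (l t x) (profile t w x))
    rw [← hκ, ENNReal.ofReal_add (by positivity) (by positivity),
      ENNReal.ofReal_add (by positivity) (by positivity),
      ENNReal.ofReal_mul (p := κ * δ) (by positivity),
      ENNReal.ofReal_mul (p := κ * δ⁻¹) (by positivity),
      ENNReal.ofReal_mul (p := κ * δ⁻¹) (by positivity),
      ENNReal.ofReal_add (sq_nonneg ‖l t x‖) (sq_nonneg _)] at h
    simp only [ENNReal.ofReal_pow (norm_nonneg _), ofReal_norm] at h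
    have hc : ‖conj (profile t g x)‖ₑ = ‖profile t g x‖ₑ := by
      rw [← ofReal_norm, RCLike.norm_conj, ofReal_norm]
    rw [enorm_mul, hc]
    refine (mul_le_mul_left h _).trans_eq ?_
    rw [add_mul, add_mul, mul_assoc, mul_assoc, mul_assoc]
  have hWm : AEMeasurable (fun x => ‖profile t w x‖ₑ ^ 2 * ‖profile t g x‖ₑ) volume :=
    ((aestronglyMeasurable_profile ht (Lp.aestronglyMeasurable w)).enorm.pow_const 2).mul
      (aestronglyMeasurable_profile ht g.continuous.aestronglyMeasurable).enorm
  have hlm : AEMeasurable (fun x => (‖l t x‖ₑ ^ 2 + ‖V t x‖ₑ ^ 2) * ‖profile t g x‖ₑ) volume :=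
    ((hl.1.enorm.pow_const 2).add (hV.1.enorm.pow_const 2)).mul
      (aestronglyMeasurable_profile ht g.continuous.aestronglyMeasurable).enorm
  have hsum : AEMeasurable (fun x => c₁ * (‖profile t w x‖ₑ ^ 2 * ‖profile t g x‖ₑ)
      + c₂ * ((‖l t x‖ₑ ^ 2 + ‖V t x‖ₑ ^ 2) * ‖profile t g x‖ₑ)) volume :=
    (hWm.const_mul c₁).add (hlm.const_mul c₂)
  have hle : ‖∫ x, (forcing μ (V t) u x - powerNonlinearity μ 1 (profile t w x))
        * conj (profile t g x)‖ₑ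
      ≤ ENNReal.ofReal (decayRate d t * (κ * (δ * P + δ⁻¹ * (Q + R)))) := by
    calc _ ≤ _ := enorm_integral_le_lintegral_enorm _
      _ ≤ _ := lintegral_mono hpt
      _ = c₁ * (∫⁻ x, ‖profile t w x‖ₑ ^ 2 * ‖profile t g x‖ₑ)
          + c₂ * (∫⁻ x, (‖l t x‖ₑ ^ 2 + ‖V t x‖ₑ ^ 2) * ‖profile t g x‖ₑ)
          + c₂ * ∫⁻ x, ‖u x - l t x - profile t w x‖ₑ ^ 2 * ‖profile t g x‖ₑ := by
        rw [lintegral_add_left' hsum,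
          lintegral_add_left' (hWm.const_mul c₁), lintegral_const_mul' _ _ ENNReal.ofReal_ne_top,
          lintegral_const_mul' _ _ ENNReal.ofReal_ne_top,
          lintegral_const_mul' _ _ ENNReal.ofReal_ne_top]
      _ ≤ c₁ * (ENNReal.ofReal (decayRate d t) * ENNReal.ofReal P)
          + c₂ * (ENNReal.ofReal (decayRate d t) * ENNReal.ofReal Q)
          + c₂ * (ENNReal.ofReal (decayRate d t) * ENNReal.ofReal R) := by
        rw [lintegral_profile_sq_mul_profile ht, lintegral_mul_profile_eq_rescaledMass ht]
        gcongr
        refine (lintegral_sq_mul_profile_le ht (fun x => u x - l t x - profile t w x) g hM).trans ?_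
        gcongr
      _ = _ := by
        rw [hc₁, hc₂, ← ENNReal.ofReal_mul hρ.le, ← ENNReal.ofReal_mul hρ.le,
          ← ENNReal.ofReal_mul hρ.le, ← ENNReal.ofReal_mul (by positivity),
          ← ENNReal.ofReal_mul (by positivity), ← ENNReal.ofReal_mul (by positivity),
          ← ENNReal.ofReal_add (by positivity) (by positivity),
          ← ENNReal.ofReal_add (by positivity) (by positivity)]
        congr 1
        ring
  rw [← ofReal_norm] at hle
  exact (ENNReal.ofReal_le_ofReal_iff (by positivity)).1 hle

/-- Lower bound for the forcing term tested against a free Schwartz solution. -/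
theorem le_re_pairing_forcing {t δ : ℝ} (ht : 0 < t) (hδ : 0 < δ) (hδ1 : δ ≤ 1) {μ : ℂ}
    (hμ : μ ≠ 0) {V l : ℝ → Space d → ℂ} (hV : MemLp (V t) 2 volume)
    (hl : MemLp (l t) 2 volume) (u w : LTwo d) (ψ : 𝓢(Space d, ℂ)) {M P Q R B C ε : ℝ}
    (hM : ∀ x, ‖𝓕 ψ x‖ ≤ M) (hP0 : 0 ≤ P) (hQ0 : 0 ≤ Q) (hR0 : 0 ≤ R)
    (hP : ∫⁻ x, ‖w x‖ₑ ^ 2 * ‖𝓕 ψ x‖ₑ ≤ ENNReal.ofReal P)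
    (hQ : rescaledMass l V (fun x => ‖𝓕 ψ ((4 * Real.pi)⁻¹ • x)‖) t ≤ ENNReal.ofReal Q)
    (hR : ENNReal.ofReal M * eLpNorm (fun x => u x - l t x - profile t w x) 2 volume ^ 2
      ≤ ENNReal.ofReal R)
    (hB : ∫ x, ‖forcing μ (V t) u x‖ ≤ B) (hC0 : 0 ≤ C)
    (hC : ∀ x, ‖freeEvolution d t ψ x - profile t (𝓕 ψ : 𝓢(Space d, ℂ)) x‖
      ≤ decayRate d t * (C / t))
    (hε : ‖(∫ x, (‖w x‖ : ℂ) * w x * conj (𝓕 ψ x)) - ((‖w‖ ^ 2 : ℝ) : ℂ)‖ ≤ ε) :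
    decayRate d t * (‖μ‖ * (‖w‖ ^ 2 - ε) - (2 + 4 * ‖μ‖) * (δ * P + δ⁻¹ * (Q + R)) - B * (C / t))
      ≤ (conj μ / (‖μ‖ : ℂ) * pairing (forcing μ (V t) u) (freeEvolution d t ψ)).re := by
  set g : 𝓢(Space d, ℂ) := 𝓕 ψ with hg
  -- This unimodular factor rotates `μ` to `|μ|`, so the main term has positive real part whatever
  -- the sign or phase of `μ`.
  set θ : ℂ := conj μ / (‖μ‖ : ℂ) with hθ
  have hμn : (‖μ‖ : ℂ) ≠ 0 := by exact_mod_cast norm_ne_zero_iff.2 hμ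
  have hθn : ‖θ‖ = 1 := by
    rw [hθ, norm_div, RCLike.norm_conj, Complex.norm_real, norm_norm,
      div_self (norm_ne_zero_iff.2 hμ)]
  have hθμ : θ * μ = (‖μ‖ : ℂ) := by
    rw [hθ, div_mul_eq_mul_div, RCLike.conj_mul, div_eq_iff hμn, ← sq]
    rfl
  have hρ := decayRate_pos (d := d) ht
  set Φ : Space d → ℂ := profile t g with hΦ
  set W : Space d → ℂ := profile t w with hW
  have hΦm : AEStronglyMeasurable Φ volume :=
    aestronglyMeasurable_profile ht g.continuous.aestronglyMeasurable
  have hΦb : ∀ x, ‖conj (Φ x)‖ ≤ decayRate d t * M := by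
    intro x
    rw [RCLike.norm_conj, hΦ, norm_profile ht]
    exact mul_le_mul_of_nonneg_left (hM _) hρ.le
  have hΦcm : AEStronglyMeasurable (fun x => conj (Φ x)) volume :=
    Complex.continuous_conj.comp_aestronglyMeasurable hΦm
  have hNi := integrable_forcing μ hV u
  have hWL : MemLp W 2 volume :=
    ⟨aestronglyMeasurable_profile ht (Lp.aestronglyMeasurable w), by
      rw [hW, eLpNorm_profile ht]; exact Lp.eLpNorm_lt_top w⟩
  have hFi := integrable_powerNonlinearity_one μ hWL
  have hNΦ : Integrable fun x => forcing μ (V t) u x * conj (Φ x) :=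
    hNi.mul_bdd (c := decayRate d t * M) hΦcm (Eventually.of_forall hΦb)
  have hFΦ : Integrable fun x => powerNonlinearity μ 1 (W x) * conj (Φ x) :=
    hFi.mul_bdd (c := decayRate d t * M) hΦcm (Eventually.of_forall hΦb)
  have hNψ := integrable_mul_conj_schwartz hNi (freeEvolution d t ψ)
  set e₁ : ℂ := pairing (forcing μ (V t) u) (fun x => freeEvolution d t ψ x - Φ x) with he₁
  set e₂ : ℂ := ∫ x, (forcing μ (V t) u x - powerNonlinearity μ 1 (W x)) * conj (Φ x) with he₂
  set I : ℂ := ∫ x, (‖w x‖ : ℂ) * w x * conj (g x) with hI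
  -- `e₁` replaces the free solution by its profile, `e₂` replaces the forcing by `μ|W|W`; the rest
  -- is the exact main term.
  have hsplit : pairing (forcing μ (V t) u) (freeEvolution d t ψ)
      = e₁ + e₂ + (decayRate d t : ℂ) * (μ * I) := by
    rw [hI, ← integral_powerNonlinearity_profile ht, he₁, he₂, pairing, pairing]
    simp only [map_sub, mul_sub, sub_mul]
    rw [integral_sub hNψ hNΦ, integral_sub hNΦ hFΦ]
    ring
  have h1 : ‖θ * e₁‖ ≤ decayRate d t * (B * (C / t)) := by
    rw [norm_mul, hθn, one_mul]
    refine (norm_pairing_le_of_norm_le hNi hC).trans ?_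
    have : 0 ≤ decayRate d t * (C / t) := by positivity
    linarith [mul_le_mul_of_nonneg_right hB this]
  have h2 : ‖θ * e₂‖ ≤ decayRate d t * ((2 + 4 * ‖μ‖) * (δ * P + δ⁻¹ * (Q + R))) := by
    rw [norm_mul, hθn, one_mul]
    exact norm_integral_forcing_sub_le ht hδ hδ1 μ hV hl u w g hM hP0 hQ0 hR0 hP hQ hR
  have h3 : decayRate d t * (‖μ‖ * (‖w‖ ^ 2 - ε)) ≤ (θ * ((decayRate d t : ℂ) * (μ * I))).re := by
    have he : θ * ((decayRate d t : ℂ) * (μ * I)) = ((decayRate d t * ‖μ‖ : ℝ) : ℂ) * I := by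
      push_cast
      rw [← hθμ]
      ring
    rw [he, Complex.re_ofReal_mul, ← mul_assoc]
    refine mul_le_mul_of_nonneg_left ?_ (by positivity)
    have := (abs_le.1 ((Complex.abs_re_le_norm _).trans hε)).1
    rw [Complex.sub_re, Complex.ofReal_re] at this
    linarith
  have h0 : θ * (e₁ + e₂ + (decayRate d t : ℂ) * (μ * I))
      = θ * e₁ + θ * e₂ + θ * ((decayRate d t : ℂ) * (μ * I)) := by ring
  rw [hsplit, h0, Complex.add_re, Complex.add_re]
  have h4 := (abs_le.1 ((Complex.abs_re_le_norm _).trans h1)).1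
  have h5 := (abs_le.1 ((Complex.abs_re_le_norm _).trans h2)).1
  linarith

/-! ### Essential limits in time -/

lemma exists_ae_of_eventually_essAtTop {P : ℝ → Prop} (h : ∀ᶠ t in essAtTop, P t) :
    ∃ T : ℝ, ∀ᵐ t : ℝ, T ≤ t → P t := by
  obtain ⟨s, hs, t, ht, hst⟩ := mem_inf_iff_superset.1 h
  obtain ⟨T, hT⟩ := mem_atTop_sets.1 hs
  refine ⟨T, ?_⟩
  filter_upwards [ht] with x hx hTx
  exact hst ⟨hT x hTx, hx⟩

lemma eventually_essAtTop_of_atTop {P : ℝ → Prop} (h : ∀ᶠ t in atTop, P t) :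
    ∀ᶠ t in essAtTop, P t :=
  h.filter_mono inf_le_left

lemma eventually_essAtTop_of_ae_Ioi {P : ℝ → Prop}
    (h : ∀ᵐ t ∂(volume.restrict (Ioi (0 : ℝ))), P t) : ∀ᶠ t in essAtTop, P t := by
  have h1 : ∀ᶠ t in essAtTop, t ∈ Ioi (0 : ℝ) → P t :=
    ((ae_restrict_iff' measurableSet_Ioi).1 h).filter_mono inf_le_right
  filter_upwards [h1, eventually_essAtTop_of_atTop (eventually_gt_atTop 0)] with t h2 h3
  exact h2 h3

lemma MemLinftyTimeLTwoInterLq.eventually_memLp {q : ℝ≥0∞} {f : ℝ → Space d → ℂ}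
    (hf : MemLinftyTimeLTwoInterLq q f) :
    ∃ C : ℝ, 0 ≤ C ∧ ∀ᶠ t in essAtTop, MemLp (f t) 2 volume
      ∧ eLpNorm (f t) 2 volume ≤ ENNReal.ofReal C := by
  obtain ⟨C, hC⟩ := hf.bounded
  refine ⟨max C 0, le_max_right _ _, eventually_essAtTop_of_ae_Ioi ?_⟩
  filter_upwards [hC, hf.aestronglyMeasurable.prodMk_left] with t h1 h2
  have h3 := h1.1.trans (ENNReal.ofReal_le_ofReal (le_max_left C 0))
  exact ⟨⟨h2, h3.trans_lt ENNReal.ofReal_lt_top⟩, h3⟩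

/-- A set of full measure is dense, so by continuity the bound extends to every time strictly after
`T`, where a whole neighbourhood is available. -/
lemma norm_le_of_ae_norm_le {E : Type*} [NormedAddCommGroup E] {u : ℝ → E} {T B : ℝ} (hT : 0 ≤ T)
    (hu : ContinuousOn u (Ici 0)) (h : ∀ᵐ t : ℝ, T ≤ t → ‖u t‖ ≤ B) {t : ℝ} (ht : T < t) :
    ‖u t‖ ≤ B := by
  by_contra! hlt
  have hc : ContinuousAt u t := hu.continuousAt (Ici_mem_nhds (hT.trans_lt ht))
  have hnhds : {s | T < s ∧ B < ‖u s‖} ∈ 𝓝 t :=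
    (eventually_gt_nhds ht).and (hc.norm.eventually (eventually_gt_nhds hlt))
  obtain ⟨s, hs, hs'⟩ := (Measure.dense_of_ae h).inter_nhds_nonempty hnhds
  exact absurd (hs hs'.1.le) (not_le.2 hs'.2)

/-! ### The equation with forcing term -/

lemma testedRHS_ae_eq {μ : ℂ} {V : ℝ → Space d → ℂ} {u : ℝ → LTwo d}
    (hu : IsForwardGlobalSolution μ 1 V u) (φ : 𝓢(Space d, ℂ)) :
    ∀ᵐ s : ℝ, 0 < s → testedRHS μ 1 (V s) (u s) φ
      = -pairing (u s) (Δ φ : 𝓢(Space d, ℂ)) + pairing (forcing μ (V s) (u s)) φ := by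
  filter_upwards [(ae_restrict_iff' measurableSet_Ioi).1 (hu.pairing_defined φ)] with s hs h0
  obtain ⟨h1, h2⟩ := hs h0
  have h3 : pairing (forcing μ (V s) (u s)) φ
      = pairing (fun x => V s x * u s x) φ
        + pairing (fun x => powerNonlinearity μ 1 (u s x)) φ := by
    simp only [pairing, forcing, add_mul]
    exact integral_add h1 h2
  rw [testedRHS, h3, add_assoc]

lemma intervalIntegrable_forcing_pairing {μ : ℂ} {V : ℝ → Space d → ℂ} {u : ℝ → LTwo d}
    (hu : IsForwardGlobalSolution μ 1 V u) (φ : 𝓢(Space d, ℂ)) {a b : ℝ} (ha : 0 ≤ a)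
    (hab : a ≤ b) : IntervalIntegrable (fun s => -pairing (u s) (Δ φ : 𝓢(Space d, ℂ))
      + pairing (forcing μ (V s) (u s)) φ) volume a b := by
  have h := (hu.locally_integrable φ b (ha.trans hab)).mono_set (c := a) (d := b) (by
    rw [uIcc_of_le hab, uIcc_of_le (ha.trans hab)]
    exact Icc_subset_Icc_left ha)
  refine h.congr_ae ?_
  rw [EventuallyEq, ae_restrict_iff' measurableSet_uIoc]
  filter_upwards [testedRHS_ae_eq hu φ] with s hs hsab
  rw [uIoc_of_le hab] at hsab
  exact hs (ha.trans_lt hsab.1)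

lemma equation_forcing {μ : ℂ} {V : ℝ → Space d → ℂ} {u : ℝ → LTwo d}
    (hu : IsForwardGlobalSolution μ 1 V u) (φ : 𝓢(Space d, ℂ)) {a b : ℝ} (ha : 0 ≤ a)
    (hab : a ≤ b) : Complex.I * (pairing (u b) φ - pairing (u a) φ)
      = ∫ s in a..b, (-pairing (u s) (Δ φ : 𝓢(Space d, ℂ))
        + pairing (forcing μ (V s) (u s)) φ) := by
  have h1 : ∫ s in a..b, (-pairing (u s) (Δ φ : 𝓢(Space d, ℂ))
        + pairing (forcing μ (V s) (u s)) φ) = ∫ s in a..b, testedRHS μ 1 (V s) (u s) φ := by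
    refine intervalIntegral.integral_congr_ae ?_
    filter_upwards [testedRHS_ae_eq hu φ] with s hs hsab
    rw [uIoc_of_le hab] at hsab
    exact (hs (ha.trans_lt hsab.1)).symm
  rw [h1, ← intervalIntegral.integral_interval_sub_left
    (hu.locally_integrable φ b (ha.trans hab)) (hu.locally_integrable φ a ha),
    ← hu.equation φ b (ha.trans hab), ← hu.equation φ a ha]
  ring

/-! ### Remainders and rescaled masses -/

lemma tendsto_eLpNorm_sub_profile {l : ℝ → Space d → ℂ} {u : ℝ → LTwo d} {v : LTwo d}
    (hl : ∀ᶠ t in essAtTop, AEStronglyMeasurable (l t) volume)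
    (h : Tendsto (fun t : ℝ => eLpNorm (fun x => u t x - l t x - freeSchrodinger t v x) 2 volume)
      essAtTop (𝓝 0)) :
    Tendsto (fun t : ℝ => eLpNorm (fun x => u t x - l t x - profile t (𝓕 v : LTwo d) x) 2 volume)
      essAtTop (𝓝 0) := by
  have h2 := h.add ((tendsto_eLpNorm_freeSchrodinger_sub_profile v).mono_left
    (inf_le_left : essAtTop ≤ atTop))
  rw [add_zero] at h2
  refine tendsto_of_tendsto_of_tendsto_of_le_of_le' tendsto_const_nhds h2
    (Eventually.of_forall fun _ => zero_le) ?_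
  filter_upwards [hl, eventually_essAtTop_of_atTop (eventually_gt_atTop 0)] with t hlt ht
  have he : (fun x => u t x - l t x - profile t (𝓕 v : LTwo d) x)
      = (fun x => u t x - l t x - freeSchrodinger t v x)
        + fun x => freeSchrodinger t v x - profile t (𝓕 v : LTwo d) x := by
    funext x
    simp only [Pi.add_apply]
    ring
  rw [he]
  exact eLpNorm_add_le (((Lp.aestronglyMeasurable _).sub hlt).sub (Lp.aestronglyMeasurable _))
    ((Lp.aestronglyMeasurable _).sub
      (aestronglyMeasurable_profile ht (Lp.aestronglyMeasurable _))) one_le_two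

lemma exists_eventually_norm_le {l : ℝ → Space d → ℂ} {u : ℝ → LTwo d} {v : LTwo d} {C : ℝ}
    (hC : 0 ≤ C)
    (hl : ∀ᶠ t in essAtTop, MemLp (l t) 2 volume ∧ eLpNorm (l t) 2 volume ≤ ENNReal.ofReal C)
    (h : Tendsto (fun t : ℝ => eLpNorm (fun x => u t x - l t x - freeSchrodinger t v x) 2 volume)
      essAtTop (𝓝 0)) :
    ∀ᶠ t in essAtTop, ‖u t‖ ≤ 1 + C + ‖v‖ := by
  filter_upwards [hl, h.eventually_le_const (u := 1) one_pos] with t hlt h1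
  have hm : AEStronglyMeasurable (fun x => u t x - l t x - freeSchrodinger t v x) volume :=
    ((Lp.aestronglyMeasurable _).sub hlt.1.1).sub (Lp.aestronglyMeasurable _)
  have he : (⇑(u t) : Space d → ℂ)
      = ((fun x => u t x - l t x - freeSchrodinger t v x) + l t) + ⇑(freeSchrodinger t v) := by
    funext x
    simp only [Pi.add_apply]
    ring
  have hv : eLpNorm (freeSchrodinger t v) 2 volume ≤ ENNReal.ofReal ‖v‖ := by
    rw [← Lp.enorm_def, ← ofReal_norm]
    exact ENNReal.ofReal_le_ofReal (norm_freeSchrodinger_le t v)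
  have h2 : eLpNorm (u t) 2 volume ≤ ENNReal.ofReal (1 + C + ‖v‖) := by
    rw [ENNReal.ofReal_add (by positivity) (norm_nonneg v), ENNReal.ofReal_add zero_le_one hC,
      ENNReal.ofReal_one]
    nth_rw 1 [he]
    refine (eLpNorm_add_le (hm.add hlt.1.1) (Lp.aestronglyMeasurable _) one_le_two).trans
      (add_le_add ?_ hv)
    exact (eLpNorm_add_le hm hlt.1.1 one_le_two).trans (add_le_add h1 hlt.2)
  rw [Lp.norm_def]
  exact ENNReal.toReal_le_of_le_ofReal (by positivity) h2

/-- The rescaled norm of a Schwartz function, as a function vanishing at infinity. -/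
def normCompSmul (g : 𝓢(Space d, ℂ)) {c : ℝ} (hc : c ≠ 0) : C₀(Space d, ℝ) where
  toFun x := ‖g (c • x)‖
  continuous_toFun := by
    have := g.continuous
    fun_prop
  zero_at_infty' := by
    have h1 : Tendsto (fun x : Space d => g x) (cocompact (Space d)) (𝓝 0) :=
      g.toZeroAtInfty.zero_at_infty'
    have h2 := h1.comp (Homeomorph.smulOfNeZero c hc).isClosedEmbedding.tendsto_cocompact
    exact tendsto_zero_iff_norm_tendsto_zero.1 h2

/-- The limsup hypothesis with test function `|g(c·)|` bounds the limsup by `ε`; doubling makes the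
inequality strict, hence eventually valid. -/
lemma eventually_rescaledMass_le {l V : ℝ → Space d → ℂ} {ν : Measure (Space d)}
    (hν : ∀ φ : C₀(Space d, ℝ), (∀ x, 0 ≤ φ x) →
      limsup (rescaledMass l V φ) essAtTop ≤ ∫⁻ x, ENNReal.ofReal (φ x) ∂ν)
    (g : 𝓢(Space d, ℂ)) {c : ℝ} (hc : c ≠ 0) {ε : ℝ} (hε : 0 < ε)
    (hg : ∫⁻ x, ‖g x‖ₑ ∂(ν.map fun x => c • x) ≤ ENNReal.ofReal ε) :
    ∀ᶠ t in essAtTop, rescaledMass l V (fun x => ‖g (c • x)‖) t ≤ ENNReal.ofReal (2 * ε) := by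
  have h := hν (normCompSmul g hc) fun x => (norm_nonneg (g (c • x)) :)
  have h1 : ∫⁻ x, ENNReal.ofReal (normCompSmul g hc x) ∂ν
      = ∫⁻ x, ‖g x‖ₑ ∂(ν.map fun x => c • x) := by
    rw [lintegral_map g.continuous.measurable.enorm (by fun_prop)]
    refine lintegral_congr fun x => ?_
    exact ofReal_norm (g (c • x))
  rw [h1] at h
  have h2 : limsup (rescaledMass l V (normCompSmul g hc)) essAtTop < ENNReal.ofReal (2 * ε) :=
    (h.trans hg).trans_lt ((ENNReal.ofReal_lt_ofReal_iff (by linarith)).2 (by linarith))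
  filter_upwards [eventually_lt_of_limsup_lt h2] with t ht
  exact ht.le

end LongRangeNLS

end

/-! ### Choice of constants and conclusion -/

theorem theorem1p2 (d : ℕ) (hd : 1 ≤ d) (hpd : (1 : ℝ) ≤ 2 / (d : ℝ))
    (μ : ℂ) (hμ : μ ≠ 0)
    (V l : ℝ → LongRangeNLS.Space d → ℂ)
    (qV : ℝ≥0∞) (hqV₁ : 1 ≤ qV) (hqV₂ : qV < 2)
    (hV : LongRangeNLS.MemLinftyTimeLTwoInterLq qV V)
    (ql : ℝ≥0∞) (hql₁ : 1 ≤ ql) (hql₂ : ql < 2)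
    (hl : LongRangeNLS.MemLinftyTimeLTwoInterLq ql l)
    (u : ℝ → LongRangeNLS.LTwo d)
    (hu : LongRangeNLS.IsForwardGlobalSolution μ 1 V u)
    (vPlus : LongRangeNLS.LTwo d)
    (hdecomp : Tendsto
      (fun t : ℝ => eLpNorm
        (fun x => u t x - l t x - LongRangeNLS.freeSchrodinger t vPlus x) 2 volume)
      LongRangeNLS.essAtTop (𝓝 0))
    (ν : Measure (LongRangeNLS.Space d)) [IsFiniteMeasure ν]
    (hνsing : ν ⟂ₘ (volume : Measure (LongRangeNLS.Space d)))
    (hν : ∀ φ : C₀(LongRangeNLS.Space d, ℝ), (∀ x, 0 ≤ φ x) →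
      limsup (LongRangeNLS.rescaledMass l V φ) LongRangeNLS.essAtTop
        ≤ ∫⁻ x, ENNReal.ofReal (φ x) ∂ν) :
    vPlus = 0 := by
  by_contra hne
  have hpi := Real.pi_pos
  set w : LongRangeNLS.LTwo d := 𝓕 vPlus with hw
  obtain ⟨CV, hCV0, hCV⟩ := hV.eventually_memLp
  obtain ⟨Cl, hCl0, hCl⟩ := hl.eventually_memLp
  have hubd := LongRangeNLS.exists_eventually_norm_le hCl0 hCl hdecomp
  set B₀ : ℝ := 1 + Cl + ‖vPlus‖ with hB₀
  have hB₀0 : 0 ≤ B₀ := by positivity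
  -- One constant dominating both the `L²` norm of `u` and the `L¹` norm of the forcing.
  set B : ℝ := B₀ + (CV ^ 2 + (1 + ‖μ‖) * B₀ ^ 2) with hB
  have hB₁0 : 0 ≤ CV ^ 2 + (1 + ‖μ‖) * B₀ ^ 2 := by positivity
  have hB0 : 0 ≤ B := add_nonneg hB₀0 hB₁0
  have hm : 0 < ‖μ‖ := norm_pos_iff.2 hμ
  set A : ℝ := ‖w‖ ^ 2 with hA
  have hA0 : 0 < A := by
    rw [hA, hw, Lp.norm_fourier_eq]
    have := norm_pos_iff.2 hne
    positivity
  set κ : ℝ := 2 + 4 * ‖μ‖ with hκ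
  have hκ0 : 0 < κ := by positivity
  -- The main term is `‖μ‖A`, and each of four errors is allotted an eighth of it. `δ` must precede
  -- `ε`, which has to beat `δ⁻¹`; `ψ` depends on `ε`, and the starting time on `ψ`.
  obtain ⟨δ, hδ, hδ1, hδA⟩ : ∃ δ : ℝ, 0 < δ ∧ δ ≤ 1 ∧ κ * (δ * (2 * A)) ≤ ‖μ‖ * A / 8 := by
    refine ⟨min 1 (‖μ‖ / (16 * κ)), by positivity, min_le_left _ _, ?_⟩
    calc κ * (min 1 (‖μ‖ / (16 * κ)) * (2 * A)) ≤ κ * (‖μ‖ / (16 * κ) * (2 * A)) := by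
          gcongr
          exact min_le_right _ _
      _ = ‖μ‖ * A / 8 := by field_simp; norm_num
  obtain ⟨ε, hε, hεA, hεδ⟩ : ∃ ε : ℝ, 0 < ε ∧ ε ≤ A / 8 ∧
      κ * (δ⁻¹ * (2 * ε + ε)) ≤ ‖μ‖ * A / 8 := by
    refine ⟨min (A / 8) (δ * ‖μ‖ * A / (24 * κ)), by positivity, min_le_left _ _, ?_⟩
    calc _ = κ * (δ⁻¹ * (3 * min (A / 8) (δ * ‖μ‖ * A / (24 * κ)))) := by ring
      _ ≤ κ * (δ⁻¹ * (3 * (δ * ‖μ‖ * A / (24 * κ)))) := by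
          gcongr
          exact min_le_right _ _
      _ = ‖μ‖ * A / 8 := by field_simp; norm_num
  have hc : (4 * Real.pi)⁻¹ ≠ 0 := by positivity
  obtain ⟨g, hg1, hg2, hg3⟩ := LongRangeNLS.exists_schwartz_approx_phase w
    (ν.map fun x => (4 * Real.pi)⁻¹ • x) (LongRangeNLS.mutuallySingular_map_smul hνsing hc) hε
  obtain ⟨ψ, rfl⟩ : ∃ ψ : 𝓢(LongRangeNLS.Space d, ℂ), 𝓕 ψ = g :=
    (FourierTransform.fourierEquiv ℂ 𝓢(LongRangeNLS.Space d, ℂ)).surjective g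
  obtain ⟨M, hM⟩ : ∃ M, ∀ x, ‖𝓕 ψ x‖ ≤ M := ⟨_, SchwartzMap.norm_le_seminorm ℝ (𝓕 ψ)⟩
  obtain ⟨C, hC0, hC⟩ := LongRangeNLS.norm_freeEvolution_sub_profile_le ψ
  have hQ := LongRangeNLS.eventually_rescaledMass_le hν (𝓕 ψ) hc hε hg2
  have hR : ∀ᶠ t in LongRangeNLS.essAtTop, ENNReal.ofReal M * eLpNorm
      (fun x => u t x - l t x - LongRangeNLS.profile t w x) 2 volume ^ 2 ≤ ENNReal.ofReal ε := by
    have h1 := LongRangeNLS.tendsto_eLpNorm_sub_profile (hCl.mono fun t ht => ht.1.1) hdecomp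
    have h2 := ENNReal.Tendsto.const_mul (a := ENNReal.ofReal M)
      ((ENNReal.continuous_pow 2).tendsto 0 |>.comp h1) (Or.inr ENNReal.ofReal_ne_top)
    rw [zero_pow two_ne_zero, mul_zero] at h2
    exact h2.eventually_le_const (ENNReal.ofReal_pos.2 hε)
  have hlarge : ∀ᶠ t : ℝ in atTop, 1 ≤ t ∧ B * (C / t) ≤ ‖μ‖ * A / 8 := by
    refine (eventually_ge_atTop 1).and ?_
    have : Tendsto (fun t : ℝ => B * (C / t)) atTop (𝓝 (B * 0)) :=
      (tendsto_const_nhds.div_atTop tendsto_id).const_mul B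
    rw [mul_zero] at this
    exact this.eventually_le_const (by positivity)
  obtain ⟨T₀, hT₀⟩ := LongRangeNLS.exists_ae_of_eventually_essAtTop
    (hCV.and (hCl.and (hubd.and (hQ.and (hR.and
      (LongRangeNLS.eventually_essAtTop_of_atTop hlarge))))))
  -- The shift by one makes `T` positive and leaves room for `norm_le_of_ae_norm_le`, which only
  -- reaches strictly later times.
  set T : ℝ := max T₀ 0 + 1 with hT
  have hTpos : 0 < T := by positivity
  have hTT : T₀ ≤ T := (le_max_left T₀ 0).trans (by linarith)
  have hub : ∀ s, T ≤ s → ‖u s‖ ≤ B₀ := by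
    intro s hs
    refine LongRangeNLS.norm_le_of_ae_norm_le (T := max T₀ 0) (le_max_right _ _) hu.continuousOn
      ?_ (lt_of_lt_of_le (by linarith) hs)
    filter_upwards [hT₀] with t h1 h2
    exact (h1 ((le_max_left _ _).trans h2)).2.2.1
  refine LongRangeNLS.false_of_pairing_freeEvolution_ge (u := u)
    (N := fun s => LongRangeNLS.forcing μ (V s) (u s)) (T := T) (B := B)
    -- Half of the main term survives the errors, and `decayRate d s ≥ (4πs)⁻¹`.
    (c := ‖μ‖ * A / (8 * Real.pi)) hTpos (by positivity)
    (fun s hs => (hub s hs).trans (by linarith)) ?_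
    (fun φ a b ha hab => LongRangeNLS.intervalIntegrable_forcing_pairing hu φ
      (hTpos.le.trans ha) hab)
    (fun φ a b ha hab => LongRangeNLS.equation_forcing hu φ (hTpos.le.trans ha) hab)
    ψ (θ := conj μ / (‖μ‖ : ℂ)) ?_ ?_
  · filter_upwards [hT₀] with s hs hTs
    have h1 := hs (hTT.trans hTs)
    refine ⟨LongRangeNLS.integrable_forcing μ h1.1.1 (u s), ?_⟩
    refine (LongRangeNLS.integral_norm_forcing_le μ h1.1.1 (u s) hCV0 h1.1.2).trans ?_
    have h2 : ‖u s‖ ^ 2 ≤ B₀ ^ 2 := pow_le_pow_left₀ (norm_nonneg _) (hub s hTs) 2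
    have h3 := mul_le_mul_of_nonneg_left h2 (by positivity : 0 ≤ 1 + ‖μ‖)
    linarith
  · rw [norm_div, RCLike.norm_conj, Complex.norm_real, norm_norm, div_self hm.ne']
  · filter_upwards [hT₀] with s hs hTs
    obtain ⟨⟨hVs, hVb⟩, ⟨hls, -⟩, -, hQs, hRs, hs1, hBs⟩ := hs (hTT.trans hTs)
    have hs0 : 0 < s := zero_lt_one.trans_le hs1
    have hBf : ∫ x, ‖LongRangeNLS.forcing μ (V s) (u s) x‖ ≤ B := by
      refine (LongRangeNLS.integral_norm_forcing_le μ hVs (u s) hCV0 hVb).trans ?_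
      have h2 : ‖u s‖ ^ 2 ≤ B₀ ^ 2 := pow_le_pow_left₀ (norm_nonneg _) (hub s hTs) 2
      have h3 := mul_le_mul_of_nonneg_left h2 (by positivity : 0 ≤ 1 + ‖μ‖)
      linarith
    refine le_trans ?_ (LongRangeNLS.le_re_pairing_forcing hs0 hδ hδ1 hμ hVs hls (u s) w ψ hM
      (P := A + ε) (by positivity) (Q := 2 * ε) (by positivity) (R := ε) hε.le hg3 hQs hRs hBf
      hC0 (hC s hs0) hg1)
    have hP : κ * (δ * (A + ε)) ≤ κ * (δ * (2 * A)) := by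
      gcongr
      linarith
    have hmε : ‖μ‖ * ε ≤ ‖μ‖ * (A / 8) := mul_le_mul_of_nonneg_left hεA hm.le
    have hbr : ‖μ‖ * A / 2 ≤ ‖μ‖ * (A - ε) - κ * (δ * (A + ε) + δ⁻¹ * (2 * ε + ε))
        - B * (C / s) := by
      rw [mul_sub, mul_add]
      linarith
    calc ‖μ‖ * A / (8 * Real.pi) / s = (4 * Real.pi * s)⁻¹ * (‖μ‖ * A / 2) := by
          field_simp
          norm_num
      _ ≤ LongRangeNLS.decayRate d s * (‖μ‖ * A / 2) :=
          mul_le_mul_of_nonneg_right (LongRangeNLS.inv_le_decayRate hpd hs1) (by positivity)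
      _ ≤ _ := mul_le_mul_of_nonneg_left hbr (LongRangeNLS.decayRate_pos hs0).le
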